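/- Let $n\ge 4$ and $1<m\le n/2$. Let $W=W(D_n)$ be the Coxeter group of type $D_n$, $R$ its set of simple reflections, $T=\bigcup_{g\in W}g^{-1}Rg$ its set of reflections, and $\ell_T$ the length function on $W$ with respect to the generating set $T$. An element $w\in W$ is a quasi-Coxeter element if it has a reduced decomposition $w=t_1\cdots t_k$ ($t_i\in T$, $k=\ell_T(w)$) with $\langle t_1,\dots,t_k\rangle=W$. Let $w$ be a quasi-Coxeter element with Carter diagram $\Delta_{m,n}$, where $\Delta_{m,n}$ is the graph with vertices $s_1,\dots,s_n$ whose edges are those of the path $s_2 - s_3 - \cdots - s_n$ together with $s_1 - s_m$ and $s_1 - s_{m+2}$. That is, there are reflections $s_1,\dots,s_n\in T$ such that $w$ is a product of $s_1,\dots,s_n$, each used once, in an order of the form $w=w_1w_2$ where the factors of $w_1$ commute pairwise and the factors of $w_2$ commute pairwise; $\ell_T(w)=n$; and, for $i\ne j$, $s_is_j$ has order $3$ if $s_i,s_j$ are adjacent in $\Delta_{m,n}$ and order $2$ otherwise. Write $x\preceq w$ if $\ell_T(w)=\ell_T(x)+\ell_T(x^{-1}w)$, and $[1,w]=\{x\in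 W: x\preceq w\}$. Let $G_{m,n}=G([1,w])$ be the interval group: the group with generators $\boldsymbol{x}$, one for each $x\in[1,w]$, and relations $\boldsymbol{u}\boldsymbol{v}=\boldsymbol{r}$ whenever $u,v,r\in[1,w]$, $uv=r$ and $\ell_T(r)=\ell_T(u)+\ell_T(v)$. Then $s_1,\dots,s_n\in[1,w]$, there is exactly one homomorphism $G_{m,n}\to W$ with $\boldsymbol{s}_i\mapsto s_i$ for all $i$, and the abelianisation of its kernel has a generating set of size at most $|T|-2$. -/

import Mathlib

namespace IntervalGroups

/-! ### Reflection length, absolute order and interval groups -/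

section General

variable {W : Type*} [Group W]

/-- The set `⋃_{g ∈ W} g⁻¹ R g` of all conjugates of elements of `R`. For a Coxeter system
`(W, R)` this is the set of reflections of `W`. -/
def reflections (R : Set W) : Set W :=
  {t | ∃ g : W, ∃ r ∈ R, t = g⁻¹ * r * g}

/-- The length `ℓ_T(w)` with respect to `T`: the least `k` such that `w` is a product of `k` elements
of `T`. It is only used for sets `T` of involutions generating `W`, so that such a `k` exists. -/
noncomputable def reflectionLength (T : Set W) (w : W) : ℕ :=
  sInf {k | ∃ l : List W, (∀ t ∈ l, t ∈ T) ∧ l.length = k ∧ l.prod = w}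

/-- `l` is a reduced decomposition of `w` over `T`. -/
def IsReducedDecomposition (T : Set W) (w : W) (l : List W) : Prop :=
  (∀ t ∈ l, t ∈ T) ∧ l.prod = w ∧ l.length = reflectionLength T w

/-- `w` is a quasi-Coxeter element: it has a reduced decomposition whose factors generate `W`. -/
def IsQuasiCoxeter (T : Set W) (w : W) : Prop :=
  ∃ l : List W, IsReducedDecomposition T w l ∧ Subgroup.closure {t | t ∈ l} = ⊤

/-- The absolute order `x ≼ w`: `x` is a left divisor of `w` and the reflection lengths add up. -/
def AbsLE (T : Set W) (x w : W) : Prop :=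
  ∃ y : W, w = x * y ∧ reflectionLength T w = reflectionLength T x + reflectionLength T y

/-- The interval `[1, w]` of left divisors of `w` for the absolute order. -/
def interval (T : Set W) (w : W) : Set W := {x | AbsLE T x w}

/-- The defining relators of the interval group: `𝐮 𝐯 = 𝐫` whenever `u, v, r ∈ [1, w]`, `u v = r` and
`ℓ_T(r) = ℓ_T(u) + ℓ_T(v)`. -/
def intervalRelators (T : Set W) (w : W) : Set (FreeGroup (interval T w)) :=
  {x | ∃ u v r : interval T w, (u : W) * v = r ∧
    reflectionLength T (r : W) = reflectionLength T (u : W) + reflectionLength T (v : W) ∧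
    x = FreeGroup.of u * FreeGroup.of v * (FreeGroup.of r)⁻¹}

/-- The interval group `G([1, w])`. -/
abbrev IntervalGroup (T : Set W) (w : W) : Type _ :=
  PresentedGroup (intervalRelators T w)

/-- The generator of `G([1, w])` that corresponds to an element of `[1, w]`. -/
def gen (T : Set W) (w : W) (x : interval T w) : IntervalGroup T w :=
  PresentedGroup.of x

/-- The family `s : Fin n → W` of reflections realises the Carter diagram `Γ` (a simple graph, all bonds
being single) of the element `w`: `w` is a product of the `s i`, each used once, of the form
`w = w₁ w₂` where the factors of `w₁` commute pairwise and so do those of `w₂`, this decomposition is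
reduced, and two vertices `i ≠ j` are joined by `o(s i * s j) - 2` edges. -/
structure IsCarterDecomposition (T : Set W) (w : W) {n : ℕ} (Γ : SimpleGraph (Fin n))
    (s : Fin n → W) : Prop where
  bipartite : ∃ l₁ l₂ : List (Fin n),
    (l₁ ++ l₂).Perm (List.finRange n) ∧
    (l₁.Pairwise fun i j => Commute (s i) (s j)) ∧
    (l₂.Pairwise fun i j => Commute (s i) (s j)) ∧
    IsReducedDecomposition T w ((l₁ ++ l₂).map s)
  orderOf_eq_three : ∀ i j, i ≠ j → Γ.Adj i j → orderOf (s i * s j) = 3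
  orderOf_eq_two : ∀ i j, i ≠ j → ¬ Γ.Adj i j → orderOf (s i * s j) = 2

end General

/-! ### The Coxeter group of type `D_n` -/

/-- The group of signed permutations of the standard basis `e_0, …, e_{n-1}` of `ℤⁿ`; the pair `(ε, σ)`
acts by `e_j ↦ ε (σ j) e_{σ j}`. -/
abbrev SignedPerm (n : ℕ) : Type :=
  (Fin n → ℤˣ) ⋊[mulAutArrow] Equiv.Perm (Fin n)

/-- The Coxeter group `W(D_n)` in its standard realisation: the signed permutations with an even number
of minus signs. -/
def evenSignedPerm (n : ℕ) : Subgroup (SignedPerm n) where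
  carrier := {g | ∏ i, g.left i = 1}
  one_mem' := by simp
  mul_mem' := by
    intro a b ha hb
    have h : ∏ i, (mulAutArrow a.right b.left) i = ∏ i, b.left i :=
      Equiv.prod_comp (a.right⁻¹) b.left
    simp only [Set.mem_ofPred_eq] at ha hb ⊢
    simp only [SemidirectProduct.mul_left, Pi.mul_apply, Finset.prod_mul_distrib]
    rw [h, ha, hb, one_mul]
  inv_mem' := by
    intro a ha
    have h : ∏ i, (mulAutArrow a.right⁻¹ a.left⁻¹) i = ∏ i, a.left⁻¹ i :=
      Equiv.prod_comp (a.right⁻¹⁻¹) a.left⁻¹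
    simp only [Set.mem_ofPred_eq] at ha ⊢
    rw [SemidirectProduct.inv_left, h]
    simp [ha]

/-- `W(D_n)` as a type. -/
abbrev WD (n : ℕ) : Type := evenSignedPerm n

/-- For `i ≠ j` and a sign `ε`, the reflection along the root `e_i - ε e_j`: it exchanges `e_i` and
`ε e_j` and fixes the other basis vectors. -/
def rootReflection {n : ℕ} (i j : Fin n) (ε : ℤˣ) : SignedPerm n :=
  ⟨fun k => if k = i ∨ k = j then ε else 1, Equiv.swap i j⟩

/-- The simple reflections of `W(D_n)` (for `n ≥ 2`): those along the simple roots `e_i - e_{i+1}` for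
`0 ≤ i < n - 1`, and `e_0 + e_1`. -/
def simpleReflectionsD (n : ℕ) : Set (WD n) :=
  {r | ∃ i j : Fin n, (j : ℕ) = i + 1 ∧
    ((r : SignedPerm n) = rootReflection i j 1 ∨
      ((i : ℕ) = 0 ∧ (r : SignedPerm n) = rootReflection i j (-1)))}

/-- The set `T` of reflections of `W(D_n)`. -/
def reflectionsD (n : ℕ) : Set (WD n) := reflections (simpleReflectionsD n)

/-- The Carter diagram `Δ_{m,n}` for `2 ≤ m`; the vertex `i : Fin n` stands for `s_{i+1}`. Its edges are those
of the path `s_2 — s_3 — ⋯ — s_n`, and `s_1 — s_m`, `s_1 — s_{m+2}`. -/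
def carterDiagramD (m n : ℕ) : SimpleGraph (Fin n) :=
  SimpleGraph.fromRel fun i j : Fin n =>
    (1 ≤ (i : ℕ) ∧ (j : ℕ) = i + 1) ∨
    ((i : ℕ) = 0 ∧ ((j : ℕ) + 1 = m ∨ (j : ℕ) + 1 = m + 2))

end IntervalGroups

/-!
The whole argument takes place in the realisation of `W = W(D_n)` by signed permutations, acting
on `ℚⁿ`.

*The element `w`.* An element of `W` which fixes a nonzero vector has reflection length less than
`n` (`exists_list_prod_eq_of_fixed`), so `w`, having length `n`, has no eigenvalue `1`, all its
cycles are negative and all reflections lie below it. For the same reason, and by parity, a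
product of the reflections in the roots `α`, `β` lies below `w` as soon as `⟨(1 - w)⁻¹ α, β⟩ = 0`
(`IsCayley.compat`). The number of cycles is at least two because the product of the signs is `1`,
and at most two because `(1 - w)⁻¹` is integral on the root lattice, which is spanned by the roots
of a generating reduced decomposition (`sameCycle_of_not_sameCycle`). No cycle has length one: if
`w = w₁ w₂` negates `e_x`, then `2 e_x = ∑ ⟨e_x, α_i⟩ α_i`, which produces two vertices of
`Δ_{m,n}` with the same neighbours and then a linear dependence between the roots
(`IsCarterDecomposition.prm_apply_ne`); it is here that `m > 1` is needed. Write `(i, ± j)` for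
the reflection which exchanges `e_i` with `± e_j`, and call it a cross if `i` and `j` are on
different cycles, and a chord otherwise. The values of `⟨(1 - w)⁻¹ e_i, e_j⟩` are `0` or `± 1/2`,
and one reads off that two non-commuting reflections of which at least one is a cross, two chords
of different cycles, and the two crosses `(i, ± j)`, have a product below `w` in one of the two
orders (`Link`).

*Generation.* The interval group `G` is generated by the reflections. The group generated by the
`s_i` is transitive on the signed basis vectors, and the relations of linked pairs then give all
crosses and all chords from the `s_i` (`IsCarterDecomposition.closure_tau_eq_top`). Hence a
homomorphism with `𝐬_i ↦ s_i` is the canonical one.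

*The kernel `N`.* By dual braid relations alone, and by moving disjoint pairs into a position
where they are linked, one finds, for the generators `𝐬` and `𝐭` of any two reflections `s` and
`t`, that conjugation by `𝐬` maps the class of `𝐭` to that of the generator of `s t s` in the
quotient of `G` by the squares of all reflections, and likewise for the classes `a_t` of the
squares `𝐭²` in `N / [N, N]` (`IsDualBraidFamily.apply_eq`). The first implies that this quotient
is `W` (`ker_proj`), so that `N` is generated as a normal subgroup by the squares; with the second
it follows that `N / [N, N]` is generated by the `|T|` classes `a_t` (`closure_sqCls`).

*Two relations.* Let `1, 2` lie on one cycle and `3, 4` on the other. Put `d_{ik} = (i, k)(i, -k)`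
in `G`. For suitable orientations, `(3, 4) d_{i4} = (3, -4) d_{i3}` and `(1, 2) d_{2k} = (1, -2)
d_{1k}`, and `(1, ± 2)` commutes with `(3, ± 4)`. Comparing the squares of the four elements
`d_{ik}` yields `X_{14} + X_{23} = X_{13} + X_{24}` in `N / [N, N]`, where `X_{ik}` is the sum of
the classes of the two reflections on the coordinates `i`, `k` (`pairCls_mul_pairCls`). Its image
under the reflection exchanging `1` and `3` is `X_{34} + X_{12} = X_{13} + X_{24}`, and these two
relations make two of the generators superfluous.
-/


namespace IntervalGroups

/-! ### Signed permutations and reflections -/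

/-- The sign with which the signed permutation `g` hits the basis vector `e_i`. -/
def sgn {n : ℕ} (g : WD n) (i : Fin n) : ℤˣ := (g : SignedPerm n).left i

/-- The permutation of the coordinates underlying a signed permutation. -/
def prm {n : ℕ} (g : WD n) : Equiv.Perm (Fin n) := (g : SignedPerm n).right

section Basic

variable {n : ℕ}

lemma WD.ext' {g h : WD n} (h1 : ∀ i, sgn g i = sgn h i) (h2 : prm g = prm h) : g = h := by
  apply Subtype.ext
  apply SemidirectProduct.ext
  · exact funext h1
  · exact h2

@[simp] lemma prm_mul (g h : WD n) : prm (g * h) = prm g * prm h := rfl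

@[simp] lemma prm_one : prm (1 : WD n) = 1 := rfl

@[simp] lemma sgn_one (i : Fin n) : sgn (1 : WD n) i = 1 := rfl

@[simp] lemma prm_inv (g : WD n) : prm g⁻¹ = (prm g)⁻¹ := rfl

lemma sgn_mul (g h : WD n) (i : Fin n) : sgn (g * h) i = sgn g i * sgn h ((prm g)⁻¹ i) := rfl

lemma prod_sgn (g : WD n) : ∏ i, sgn g i = 1 := g.2

lemma rootReflection_mem {i j : Fin n} (hij : i ≠ j) (ε : ℤˣ) :
    rootReflection i j ε ∈ evenSignedPerm n := by
  change ∏ k, (if k = i ∨ k = j then ε else 1) = 1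
  have h : (fun k : Fin n => if k = i ∨ k = j then ε else 1)
      = fun k => (if k = i then ε else 1) * (if k = j then ε else 1) := by
    funext k
    by_cases h1 : k = i <;> by_cases h2 : k = j <;> simp_all
  rw [h, Finset.prod_mul_distrib]
  simp

/-- The reflection of `W(D_n)` along `e_i - ε e_j`; for `i = j`, where there is no such reflection,
it is `1` by convention. -/
def R (i j : Fin n) (ε : ℤˣ) : WD n :=
  if h : i = j then 1 else ⟨rootReflection i j ε, rootReflection_mem h ε⟩

lemma R_self (i : Fin n) (ε : ℤˣ) : R i i ε = 1 := by simp [R]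

lemma prm_R (i j : Fin n) (ε : ℤˣ) : prm (R i j ε) = Equiv.swap i j := by
  by_cases h : i = j
  · subst h; simp [R]; rfl
  · simp only [R, h, dite_false]; rfl

lemma sgn_R {i j : Fin n} (hij : i ≠ j) (ε : ℤˣ) (k : Fin n) :
    sgn (R i j ε) k = if k = i ∨ k = j then ε else 1 := by
  simp only [R, hij, dite_false]; rfl

lemma R_comm (i j : Fin n) (ε : ℤˣ) : R i j ε = R j i ε := by
  by_cases h : i = j
  · rw [h]
  · apply WD.ext'
    · intro k
      rw [sgn_R h, sgn_R (Ne.symm h)]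
      simp only [or_comm]
    · rw [prm_R, prm_R, Equiv.swap_comm]

/-- Conjugating the reflection along `e_i - ε e_j` by `g` gives the reflection along the image of that
root. -/
lemma mul_R (g : WD n) (i j : Fin n) (ε : ℤˣ) :
    g * R i j ε = R (prm g i) (prm g j) (ε * sgn g (prm g i) * sgn g (prm g j)) * g := by
  by_cases h : i = j
  · subst h; simp [R_self]
  have h' : prm g i ≠ prm g j := fun e => h ((prm g).injective e)
  apply WD.ext'
  · intro k
    rw [sgn_mul, sgn_mul, sgn_R h, sgn_R h', prm_R, Equiv.swap_inv]
    obtain ⟨l, rfl⟩ := (prm g).surjective k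
    have e : (prm g)⁻¹ (prm g l) = l := by simp
    simp only [e, (prm g).injective.eq_iff]
    by_cases h1 : l = i
    · subst h1
      simp only [true_or, if_true, Equiv.swap_apply_left]
      rw [mul_assoc, mul_assoc, Int.units_mul_self, mul_one, mul_comm]
    · by_cases h2 : l = j
      · subst h2
        simp only [or_true, if_true, Equiv.swap_apply_right]
        rw [mul_right_comm (ε * _), mul_assoc ε, Int.units_mul_self, mul_one, mul_comm]
      · have h3 : prm g l ≠ prm g i := fun e => h1 ((prm g).injective e)
        have h4 : prm g l ≠ prm g j := fun e => h2 ((prm g).injective e)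
        simp [h1, h2, Equiv.swap_apply_of_ne_of_ne h3 h4]
  · rw [prm_mul, prm_mul, prm_R, prm_R]
    exact Equiv.mul_swap_eq_swap_mul (prm g) i j

lemma conj_R (g : WD n) (i j : Fin n) (ε : ℤˣ) :
    g * R i j ε * g⁻¹ = R (prm g i) (prm g j) (ε * sgn g (prm g i) * sgn g (prm g j)) := by
  rw [mul_R, mul_inv_cancel_right]

@[simp] lemma R_mul_self (i j : Fin n) (ε : ℤˣ) : R i j ε * R i j ε = 1 := by
  by_cases h : i = j
  · subst h; simp [R_self]
  apply WD.ext'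
  · intro k
    rw [sgn_mul, sgn_R h, sgn_R h, prm_R, Equiv.swap_inv, sgn_one]
    by_cases h1 : k = i
    · simp [h1, Int.units_mul_self]
    · by_cases h2 : k = j
      · simp [h2, Int.units_mul_self]
      · simp [h1, h2, Equiv.swap_apply_of_ne_of_ne]
  · simp [prm_R]

@[simp] lemma R_inv (i j : Fin n) (ε : ℤˣ) : (R i j ε)⁻¹ = R i j ε :=
  inv_eq_of_mul_eq_one_left (R_mul_self i j ε)

lemma R_conj_share {i j k : Fin n} (hij : i ≠ j) (hik : i ≠ k) (hjk : j ≠ k) (ε δ : ℤˣ) :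
    R i j ε * R j k δ * R i j ε = R i k (ε * δ) := by
  have h := conj_R (R i j ε) j k δ
  rw [R_inv] at h
  rw [h, prm_R, Equiv.swap_apply_right, Equiv.swap_apply_of_ne_of_ne hik.symm hjk.symm,
    sgn_R hij, sgn_R hij]
  simp [hik.symm, hjk.symm, mul_comm]

lemma R_conj_disjoint {i j k l : Fin n} (hik : i ≠ k) (hil : i ≠ l) (hjk : j ≠ k)
    (hjl : j ≠ l) (ε δ : ℤˣ) : R i j ε * R k l δ * R i j ε = R k l δ := by
  by_cases hij : i = j
  · subst hij; simp [R_self]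
  have h := conj_R (R i j ε) k l δ
  rw [R_inv] at h
  rw [h, prm_R, Equiv.swap_apply_of_ne_of_ne hik.symm hjk.symm,
    Equiv.swap_apply_of_ne_of_ne hil.symm hjl.symm, sgn_R hij, sgn_R hij]
  simp [hik.symm, hjk.symm, hil.symm, hjl.symm]

lemma R_conj_same (i j : Fin n) (ε δ : ℤˣ) : R i j ε * R i j δ * R i j ε = R i j δ := by
  by_cases hij : i = j
  · subst hij; simp [R_self]
  have h := conj_R (R i j ε) i j δ
  rw [R_inv] at h
  rw [h, prm_R, Equiv.swap_apply_left, Equiv.swap_apply_right, sgn_R hij, sgn_R hij, R_comm]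
  simp [mul_assoc, Int.units_mul_self]

lemma R_ne_one {i j : Fin n} (hij : i ≠ j) (ε : ℤˣ) : R i j ε ≠ 1 := by
  intro h
  have h2 : prm (R i j ε) = 1 := by rw [h]; rfl
  rw [prm_R] at h2
  exact hij (Equiv.swap_eq_one_iff.1 h2)

lemma R_sign_injective {i j : Fin n} (hij : i ≠ j) {ε δ : ℤˣ} (h : R i j ε = R i j δ) :
    ε = δ := by
  have h1 := congrArg (fun g => sgn g i) h
  simpa [sgn_R hij] using h1

/-- The signed permutation without signs attached to a permutation of the coordinates. -/
def ofPerm (σ : Equiv.Perm (Fin n)) : WD n :=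
  ⟨⟨1, σ⟩, by change ∏ i : Fin n, (1 : Fin n → ℤˣ) i = 1; simp⟩

lemma exists_perm_pair {a b i j : Fin n} (hab : a ≠ b) (hij : i ≠ j) :
    ∃ σ : Equiv.Perm (Fin n), σ a = i ∧ σ b = j := by
  refine ⟨Equiv.swap (Equiv.swap a i b) j * Equiv.swap a i, ?_, by simp⟩
  have h1 : i ≠ Equiv.swap a i b := fun h => hab (by
    have := congrArg (Equiv.swap a i) h
    simpa using this)
  rw [Equiv.Perm.mul_apply, Equiv.swap_apply_left, Equiv.swap_apply_of_ne_of_ne h1 hij]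

lemma mem_reflectionsD (hn : 2 ≤ n) {t : WD n} :
    t ∈ reflectionsD n ↔ ∃ i j ε, i ≠ j ∧ t = R i j ε := by
  constructor
  · rintro ⟨g, r, ⟨i, j, hij, hr⟩, rfl⟩
    have hne : i ≠ j := fun h => by subst h; omega
    have hR : ∃ ε, r = R i j ε := by
      rcases hr with h | ⟨-, h⟩
      · exact ⟨1, Subtype.ext (by rw [h]; simp [R, hne])⟩
      · exact ⟨-1, Subtype.ext (by rw [h]; simp [R, hne])⟩
    obtain ⟨ε, rfl⟩ := hR
    have h := conj_R g⁻¹ i j ε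
    rw [inv_inv] at h
    exact ⟨_, _, _, fun e => hne ((prm g⁻¹).injective e), h⟩
  · rintro ⟨i, j, ε, hij, rfl⟩
    let a : Fin n := ⟨0, by omega⟩
    let b : Fin n := ⟨1, by omega⟩
    have hab : a ≠ b := by simp [a, b]
    obtain ⟨σ, h1, h2⟩ := exists_perm_pair hab hij
    refine ⟨(ofPerm σ)⁻¹, R a b ε, ⟨a, b, rfl, ?_⟩, ?_⟩
    · rcases Int.units_eq_one_or ε with rfl | rfl
      · left; simp [R, hab]
      · right; exact ⟨rfl, by simp [R, hab]⟩
    · rw [inv_inv, conj_R]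
      have e : ∀ k, sgn (ofPerm σ) k = 1 := fun k => rfl
      have e2 : prm (ofPerm σ) = σ := rfl
      rw [e, e, e2, h1, h2, mul_one, mul_one]

/-! ### The action on vectors -/

/-- The linear action of a signed permutation on `ℚⁿ`. -/
def act (g : WD n) (v : Fin n → ℚ) : Fin n → ℚ :=
  fun i => ((sgn g i : ℤ) : ℚ) * v ((prm g)⁻¹ i)

lemma act_one (v : Fin n → ℚ) : act 1 v = v := by
  funext i; simp [act]

lemma act_mul (g h : WD n) (v : Fin n → ℚ) : act (g * h) v = act g (act h v) := by
  funext i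
  simp [act, sgn_mul, mul_assoc]

lemma act_add (g : WD n) (u v : Fin n → ℚ) : act g (u + v) = act g u + act g v := by
  funext i; simp [act, mul_add]

lemma act_sub (g : WD n) (u v : Fin n → ℚ) : act g (u - v) = act g u - act g v := by
  funext i; simp [act, mul_sub]

lemma act_smul (g : WD n) (c : ℚ) (v : Fin n → ℚ) : act g (c • v) = c • act g v := by
  funext i; simp [act, mul_left_comm]

lemma units_rat_mul_self (ε : ℤˣ) : ((ε : ℤ) : ℚ) * ((ε : ℤ) : ℚ) = 1 := by
  rcases Int.units_eq_one_or ε with rfl | rfl <;> simp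

lemma act_dot (g : WD n) (u v : Fin n → ℚ) : act g u ⬝ᵥ act g v = u ⬝ᵥ v := by
  simp only [dotProduct, act]
  rw [← Equiv.sum_comp (prm g)⁻¹ (fun i => u i * v i)]
  refine Finset.sum_congr rfl fun i _ => ?_
  linear_combination (u ((prm g)⁻¹ i) * v ((prm g)⁻¹ i)) * units_rat_mul_self (sgn g i)

lemma act_single (g : WD n) (i : Fin n) (c : ℚ) :
    act g (Pi.single i c) = Pi.single (prm g i) (((sgn g (prm g i) : ℤ) : ℚ) * c) := by
  funext k
  by_cases h : k = prm g i
  · subst h; simp [act]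
  · have h' : (prm g)⁻¹ k ≠ i := fun e => h (by rw [← e]; simp)
    rw [act, Pi.single_eq_of_ne h', Pi.single_eq_of_ne h, mul_zero]

lemma act_injective {g h : WD n} (H : ∀ v, act g v = act h v) : g = h := by
  have key : ∀ i, prm g i = prm h i ∧ sgn g (prm g i) = sgn h (prm h i) := by
    intro i
    have h1 := H (Pi.single i 1)
    rw [act_single, act_single, mul_one, mul_one] at h1
    have h2 := congrFun h1 (prm g i)
    have h3 : prm g i = prm h i := by
      by_contra hne
      rw [Pi.single_eq_same, Pi.single_eq_of_ne hne] at h2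
      simp at h2
    refine ⟨h3, ?_⟩
    rw [h3, Pi.single_eq_same, Pi.single_eq_same] at h2
    rw [h3]
    exact Units.ext (by exact_mod_cast h2)
  have hp : prm g = prm h := Equiv.ext fun i => (key i).1
  refine WD.ext' (fun i => ?_) hp
  obtain ⟨k, rfl⟩ := (prm g).surjective i
  rw [(key k).2, (key k).1]

/-- The root `e_i - ε e_j`. -/
def root (i j : Fin n) (ε : ℤˣ) : Fin n → ℚ := Pi.single i 1 - Pi.single j ((ε : ℤ) : ℚ)

lemma dot_root (v : Fin n → ℚ) (i j : Fin n) (ε : ℤˣ) :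
    v ⬝ᵥ root i j ε = v i - ((ε : ℤ) : ℚ) * v j := by
  simp [root, dotProduct_sub, mul_comm]

lemma act_R {i j : Fin n} (hij : i ≠ j) (ε : ℤˣ) (v : Fin n → ℚ) :
    act (R i j ε) v = v - (v ⬝ᵥ root i j ε) • root i j ε := by
  have hε := units_rat_mul_self ε
  funext k
  rw [dot_root]
  by_cases h1 : k = i
  · subst h1
    simp [act, sgn_R hij, prm_R, root, hij]
  · by_cases h2 : k = j
    · subst h2
      simp only [act, sgn_R hij, prm_R, root, Equiv.swap_inv, Equiv.swap_apply_right, or_true,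
        if_true, Pi.sub_apply, Pi.smul_apply, smul_eq_mul, Pi.single_eq_same,
        Pi.single_eq_of_ne h1]
      linear_combination v k * hε
    · simp [act, sgn_R hij, prm_R, root, h1, h2, Equiv.swap_apply_of_ne_of_ne]

lemma act_R_of_dot_eq_zero {i j : Fin n} (hij : i ≠ j) (ε : ℤˣ) {v : Fin n → ℚ}
    (h : v ⬝ᵥ root i j ε = 0) : act (R i j ε) v = v := by
  rw [act_R hij, h]; simp

lemma root_dot_self {i j : Fin n} (hij : i ≠ j) (ε : ℤˣ) :
    root i j ε ⬝ᵥ root i j ε = 2 := by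
  have hε := units_rat_mul_self ε
  rw [dot_root]
  simp [root, hij, hij.symm, hε]
  norm_num

lemma act_list_prod_of_fixed {l : List (WD n)} {v : Fin n → ℚ} (h : ∀ t ∈ l, act t v = v) :
    act l.prod v = v := by
  induction l with
  | nil => simp [act_one]
  | cons t l ih =>
    rw [List.prod_cons, act_mul, ih fun s hs => h s (List.mem_cons_of_mem _ hs)]
    exact h t List.mem_cons_self

end Basic

/-! ### Reflection length in `W(D_n)` -/

section Length

variable {n : ℕ}

/-- The signed permutation `g` fixes the basis vector `e_i`. -/
def FixesBasis (g : WD n) (i : Fin n) : Prop := prm g i = i ∧ sgn g i = 1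

lemma FixesBasis.mul {g h : WD n} {i : Fin n} (hg : FixesBasis g i) (hh : FixesBasis h i) :
    FixesBasis (g * h) i := by
  refine ⟨by rw [prm_mul, Equiv.Perm.mul_apply, hh.1, hg.1], ?_⟩
  have h1 : (prm g)⁻¹ i = i := by rw [Equiv.Perm.inv_eq_iff_eq, hg.1]
  rw [sgn_mul, h1, hg.2, hh.2, mul_one]

lemma fixesBasis_R {i j k : Fin n} (hki : k ≠ i) (hkj : k ≠ j) (ε : ℤˣ) :
    FixesBasis (R i j ε) k := by
  by_cases hij : i = j
  · subst hij; rw [R_self]; exact ⟨rfl, rfl⟩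
  exact ⟨by rw [prm_R, Equiv.swap_apply_of_ne_of_ne hki hkj], by simp [sgn_R hij, hki, hkj]⟩

lemma FixesBasis.act_single {g : WD n} {i : Fin n} (hg : FixesBasis g i) (c : ℚ) :
    act g (Pi.single i c) = Pi.single i c := by
  rw [IntervalGroups.act_single, hg.1, hg.2]; simp

lemma fixesBasis_R_mul {x : WD n} {i j : Fin n} (hj : prm x i = j) (hij : i ≠ j) :
    FixesBasis (R i j (sgn x j) * x) i ∧
      ∀ k, FixesBasis x k → FixesBasis (R i j (sgn x j) * x) k := by
  constructor
  · constructor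
    · rw [prm_mul, Equiv.Perm.mul_apply, hj, prm_R, Equiv.swap_apply_right]
    · rw [sgn_mul, prm_R, Equiv.swap_inv, Equiv.swap_apply_left, sgn_R hij]
      simp [Int.units_mul_self]
  · intro k hk
    refine (fixesBasis_R ?_ ?_ _).mul hk
    · rintro rfl; exact hij (hk.1.symm.trans hj)
    · rintro rfl; exact hij ((prm x).injective (hj.trans hk.1.symm))

lemma exists_list_prod_eq (hn : 2 ≤ n) : ∀ (S : Finset (Fin n)) (x : WD n),
    (∀ i, i ∉ S → FixesBasis x i) →
    ∃ l : List (WD n), (∀ t ∈ l, t ∈ reflectionsD n) ∧ l.length ≤ S.card ∧ l.prod = x := by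
  intro S
  induction S using Finset.strongInduction with
  | H S ih =>
    intro x hx
    by_cases h1 : ∃ i, prm x i ≠ i
    · obtain ⟨i, hi⟩ := h1
      have hiS : i ∈ S := by
        by_contra h; exact hi (hx i h).1
      obtain ⟨h2, h3⟩ := fixesBasis_R_mul rfl hi.symm
      obtain ⟨l, hl, hlen, hprod⟩ := ih (S.erase i) (Finset.erase_ssubset hiS)
        (R i (prm x i) (sgn x (prm x i)) * x) (by
          intro k hk
          by_cases hki : k = i
          · rw [hki]; exact h2
          · exact h3 k (hx k fun hkS => hk (Finset.mem_erase.2 ⟨hki, hkS⟩)))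
      refine ⟨R i (prm x i) (sgn x (prm x i)) :: l, ?_, ?_, ?_⟩
      · intro t ht
        rcases List.mem_cons.1 ht with rfl | ht
        · exact (mem_reflectionsD hn).2 ⟨_, _, _, hi.symm, rfl⟩
        · exact hl t ht
      · rw [Finset.card_erase_of_mem hiS] at hlen
        have := Finset.card_pos.2 ⟨i, hiS⟩
        rw [List.length_cons]; omega
      · rw [List.prod_cons, hprod, ← mul_assoc, R_mul_self, one_mul]
    · push Not at h1
      have hp : prm x = 1 := Equiv.ext h1
      by_cases h2 : ∃ i, sgn x i ≠ 1
      · obtain ⟨i, hi⟩ := h2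
        have hiS : i ∈ S := by
          by_contra h; exact hi (hx i h).2
        have h3 : ∃ j, j ≠ i ∧ sgn x j ≠ 1 := by
          by_contra h
          push Not at h
          have := prod_sgn x
          rw [Finset.prod_eq_single i (fun j _ hj => h j hj) (by simp)] at this
          exact hi this
        obtain ⟨j, hji, hj⟩ := h3
        have hjS : j ∈ S := by
          by_contra h; exact hj (hx j h).2
        have hi' := (Int.units_ne_iff_eq_neg.1 hi)
        have hj' := (Int.units_ne_iff_eq_neg.1 hj)
        obtain ⟨l, hl, hlen, hprod⟩ := ih ((S.erase i).erase j)
          (Finset.ssubset_of_subset_of_ssubset (Finset.erase_subset _ _)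
            (Finset.erase_ssubset hiS)) (R i j 1 * (R i j (-1) * x)) (by
            intro k hk
            by_cases hki : k = i
            · subst hki
              constructor
              · simp [prm_R, hp]
              · simp [sgn_mul, prm_R, sgn_R hji.symm, hi']
            · by_cases hkj : k = j
              · subst hkj
                constructor
                · simp [prm_R, hp]
                · simp [sgn_mul, prm_R, sgn_R hji.symm, hj']
              · refine (fixesBasis_R hki hkj _).mul ((fixesBasis_R hki hkj _).mul (hx k ?_))
                simpa [hki, hkj] using hk)
        refine ⟨R i j (-1) :: R i j 1 :: l, ?_, ?_, ?_⟩
        · intro t ht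
          rcases List.mem_cons.1 ht with rfl | ht
          · exact (mem_reflectionsD hn).2 ⟨_, _, _, hji.symm, rfl⟩
          rcases List.mem_cons.1 ht with rfl | ht
          · exact (mem_reflectionsD hn).2 ⟨_, _, _, hji.symm, rfl⟩
          · exact hl t ht
        · have hjS' : j ∈ S.erase i := Finset.mem_erase.2 ⟨hji, hjS⟩
          rw [Finset.card_erase_of_mem hjS'] at hlen
          have h5 := Finset.card_pos.2 ⟨j, hjS'⟩
          rw [Finset.card_erase_of_mem hiS] at hlen h5
          rw [List.length_cons, List.length_cons]; omega
        · rw [List.prod_cons, List.prod_cons, hprod, ← mul_assoc (R i j 1), R_mul_self, one_mul,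
            ← mul_assoc, R_mul_self, one_mul]
      · push Not at h2
        exact ⟨[], by simp, by simp, WD.ext' (fun i => (h2 i).symm) hp.symm⟩

lemma exists_list_prod_eq_of_fixed (hn : 2 ≤ n) : ∀ (S : Finset (Fin n)) (x : WD n)
    (v : Fin n → ℚ), (∀ i, i ∉ S → FixesBasis x i) → (∀ i, i ∉ S → v i = 0) → v ≠ 0 →
    act x v = v →
    ∃ l : List (WD n), (∀ t ∈ l, t ∈ reflectionsD n) ∧ l.length + 1 ≤ S.card ∧ l.prod = x := by
  intro S
  induction S using Finset.strongInduction with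
  | H S ih =>
    intro x v hx hvS hv hxv
    by_cases h0 : ∃ i ∈ S, FixesBasis x i
    · obtain ⟨i, hiS, hi⟩ := h0
      obtain ⟨l, hl, hlen, hprod⟩ := exists_list_prod_eq hn (S.erase i) x (by
        intro k hk
        by_cases hki : k = i
        · rw [hki]; exact hi
        · exact hx k fun hkS => hk (Finset.mem_erase.2 ⟨hki, hkS⟩))
      refine ⟨l, hl, ?_, hprod⟩
      rw [Finset.card_erase_of_mem hiS] at hlen
      have := Finset.card_pos.2 ⟨i, hiS⟩
      omega
    push Not at h0
    by_cases h1 : ∃ i, prm x i ≠ i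
    · obtain ⟨i, hi⟩ := h1
      have hiS : i ∈ S := by
        by_contra h; exact hi (hx i h).1
      obtain ⟨h2, h3⟩ := fixesBasis_R_mul rfl hi.symm
      set j := prm x i with hj
      have hvj : ((sgn x j : ℤ) : ℚ) * v i = v j := by
        have h := congrFun hxv j
        have e : (prm x)⁻¹ j = i := by rw [hj]; simp
        rwa [act, e] at h
      have htv : act (R i j (sgn x j)) v = v := by
        refine act_R_of_dot_eq_zero hi.symm _ ?_
        rw [dot_root, ← hvj, ← mul_assoc, units_rat_mul_self, one_mul, sub_self]
      have hv' : v - Pi.single i (v i) ≠ 0 := by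
        intro h
        have hvi : v = Pi.single i (v i) := sub_eq_zero.1 h
        have hvj0 : v j = 0 := by rw [hvi, Pi.single_eq_of_ne hi]
        rw [hvj0] at hvj
        have hvi0 : v i = 0 := by
          rcases mul_eq_zero.1 hvj with h | h
          · simp at h
          · exact h
        rw [hvi0, Pi.single_zero] at hvi
        exact hv hvi
      obtain ⟨l, hl, hlen, hprod⟩ := ih (S.erase i) (Finset.erase_ssubset hiS)
        (R i j (sgn x j) * x) (v - Pi.single i (v i)) (by
          intro k hk
          by_cases hki : k = i
          · rw [hki]; exact h2
          · exact h3 k (hx k fun hkS => hk (Finset.mem_erase.2 ⟨hki, hkS⟩))) (by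
          intro k hk
          by_cases hki : k = i
          · rw [hki]; simp
          · simp [hki, hvS k fun hkS => hk (Finset.mem_erase.2 ⟨hki, hkS⟩)]) hv' (by
          rw [act_sub, h2.act_single, act_mul, hxv, htv])
      refine ⟨R i j (sgn x j) :: l, ?_, ?_, ?_⟩
      · intro t ht
        rcases List.mem_cons.1 ht with rfl | ht
        · exact (mem_reflectionsD hn).2 ⟨_, _, _, hi.symm, rfl⟩
        · exact hl t ht
      · rw [Finset.card_erase_of_mem hiS] at hlen
        have := Finset.card_pos.2 ⟨i, hiS⟩
        rw [List.length_cons]; omega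
      · rw [List.prod_cons, hprod, ← mul_assoc, R_mul_self, one_mul]
    · push Not at h1
      refine absurd (funext fun i => ?_) hv
      by_cases hiS : i ∈ S
      · have hs : sgn x i = -1 := Int.units_ne_iff_eq_neg.1 fun h => h0 i hiS ⟨h1 i, h⟩
        have h := congrFun hxv i
        have e : (prm x)⁻¹ i = i := by rw [Equiv.Perm.inv_eq_iff_eq, h1 i]
        rw [act, e, hs] at h
        simp at h
        rw [Pi.zero_apply]; linarith
      · exact hvS i hiS

lemma reflectionLength_le_of_list {x : WD n} {l : List (WD n)}
    (hl : ∀ t ∈ l, t ∈ reflectionsD n) (hx : l.prod = x) :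
    reflectionLength (reflectionsD n) x ≤ l.length :=
  Nat.sInf_le ⟨l, hl, rfl, hx⟩

lemma exists_reduced (hn : 2 ≤ n) (x : WD n) :
    ∃ l, IsReducedDecomposition (reflectionsD n) x l := by
  obtain ⟨l, hl, -, hx⟩ := exists_list_prod_eq hn Finset.univ x (by simp)
  have hne : {k | ∃ l : List (WD n), (∀ t ∈ l, t ∈ reflectionsD n) ∧ l.length = k ∧
      l.prod = x}.Nonempty := ⟨_, l, hl, rfl, hx⟩
  obtain ⟨l', h1, h2, h3⟩ := Nat.sInf_mem hne
  exact ⟨l', h1, h3, h2⟩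

lemma reflectionLength_le (hn : 2 ≤ n) (x : WD n) :
    reflectionLength (reflectionsD n) x ≤ n := by
  obtain ⟨l, hl, hlen, hx⟩ := exists_list_prod_eq hn Finset.univ x (by simp)
  exact (reflectionLength_le_of_list hl hx).trans (by simpa using hlen)

lemma reflectionLength_lt_of_fixed (hn : 2 ≤ n) {x : WD n} {v : Fin n → ℚ} (hv : v ≠ 0)
    (hxv : act x v = v) : reflectionLength (reflectionsD n) x < n := by
  obtain ⟨l, hl, hlen, hx⟩ := exists_list_prod_eq_of_fixed hn Finset.univ x v (by simp)
    (by simp) hv hxv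
  exact lt_of_le_of_lt (reflectionLength_le_of_list hl hx) (by simpa using hlen)

lemma reflectionLength_mul_le (hn : 2 ≤ n) (x y : WD n) :
    reflectionLength (reflectionsD n) (x * y) ≤
      reflectionLength (reflectionsD n) x + reflectionLength (reflectionsD n) y := by
  obtain ⟨l, h1, h2, h3⟩ := exists_reduced hn x
  obtain ⟨l', h1', h2', h3'⟩ := exists_reduced hn y
  rw [← h3, ← h3', ← List.length_append]
  refine reflectionLength_le_of_list ?_ (by rw [List.prod_append, h2, h2'])
  intro t ht
  rcases List.mem_append.1 ht with h | h
  exacts [h1 t h, h1' t h]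

/-- The parity of the reflection length is the sign of the underlying permutation. -/
lemma sign_eq_neg_one_pow (hn : 2 ≤ n) (x : WD n) :
    Equiv.Perm.sign (prm x) = (-1) ^ reflectionLength (reflectionsD n) x := by
  obtain ⟨l, h1, h2, h3⟩ := exists_reduced hn x
  rw [← h3, ← h2]
  clear h2 h3
  induction l with
  | nil => simp
  | cons t l ih =>
    obtain ⟨i, j, ε, hij, rfl⟩ := (mem_reflectionsD hn).1 (h1 t List.mem_cons_self)
    rw [List.prod_cons, prm_mul, map_mul, ih fun s hs => h1 s (List.mem_cons_of_mem _ hs), prm_R,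
      Equiv.Perm.sign_swap hij, List.length_cons, pow_succ, mul_comm]

lemma eq_one_of_reflectionLength_eq_zero (hn : 2 ≤ n) {x : WD n}
    (h : reflectionLength (reflectionsD n) x = 0) : x = 1 := by
  obtain ⟨l, h1, h2, h3⟩ := exists_reduced hn x
  rw [h, List.length_eq_zero_iff] at h3
  rw [← h2, h3, List.prod_nil]

lemma reflectionLength_R (hn : 2 ≤ n) {i j : Fin n} (hij : i ≠ j) (ε : ℤˣ) :
    reflectionLength (reflectionsD n) (R i j ε) = 1 := by
  have h1 : reflectionLength (reflectionsD n) (R i j ε) ≤ 1 :=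
    reflectionLength_le_of_list (l := [R i j ε])
      (by simpa using (mem_reflectionsD hn).2 ⟨i, j, ε, hij, rfl⟩) (by simp)
  have h2 : reflectionLength (reflectionsD n) (R i j ε) ≠ 0 := fun h =>
    R_ne_one hij ε (eq_one_of_reflectionLength_eq_zero hn h)
  omega

lemma neg_one_pow_unit_inj {a b : ℕ} (h : (-1 : ℤˣ) ^ a = (-1) ^ b) : a % 2 = b % 2 := by
  have h1 := fun k : ℕ => Nat.mod_two_eq_zero_or_one k
  rw [← Nat.mod_add_div a 2, ← Nat.mod_add_div b 2, pow_add, pow_add, pow_mul, pow_mul] at h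
  rcases h1 a with ha | ha <;> rcases h1 b with hb | hb <;> simp [ha, hb] at h ⊢

lemma parity_mul (hn : 2 ≤ n) (x y : WD n) :
    reflectionLength (reflectionsD n) (x * y) % 2 =
      (reflectionLength (reflectionsD n) x + reflectionLength (reflectionsD n) y) % 2 := by
  apply neg_one_pow_unit_inj
  rw [pow_add, ← sign_eq_neg_one_pow hn, ← sign_eq_neg_one_pow hn, ← sign_eq_neg_one_pow hn,
    prm_mul, map_mul]

variable {w : WD n}

/-- An element of maximal reflection length has no fixed vector. -/
lemma eq_zero_of_act_eq (hn : 2 ≤ n) (hw : reflectionLength (reflectionsD n) w = n)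
    {v : Fin n → ℚ} (h : act w v = v) : v = 0 := by
  by_contra hv
  exact absurd hw (reflectionLength_lt_of_fixed hn hv h).ne

/-- Every reflection lies below an element of maximal reflection length. -/
lemma R_mem_interval (hn : 2 ≤ n) (hw : reflectionLength (reflectionsD n) w = n) {i j : Fin n}
    (hij : i ≠ j) (ε : ℤˣ) : R i j ε ∈ interval (reflectionsD n) w := by
  refine ⟨R i j ε * w, by rw [← mul_assoc, R_mul_self, one_mul], ?_⟩
  have h1 := reflectionLength_le hn (R i j ε * w)
  have h2 := parity_mul hn (R i j ε) w
  have h3 := reflectionLength_mul_le hn (R i j ε) (R i j ε * w)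
  rw [← mul_assoc, R_mul_self, one_mul] at h3
  rw [reflectionLength_R hn hij] at h2 h3 ⊢
  omega

lemma R_mul_R_mem_interval (hn : 2 ≤ n) (hw : reflectionLength (reflectionsD n) w = n)
    {i j k l : Fin n} (hij : i ≠ j) (hkl : k ≠ l) {ε δ : ℤˣ} {u : Fin n → ℚ} (hu : u ≠ 0)
    (h : act (R k l δ * (R i j ε * w)) u = u) :
    R i j ε * R k l δ ∈ interval (reflectionsD n) w ∧
      reflectionLength (reflectionsD n) (R i j ε * R k l δ) = 2 := by
  have h1 := reflectionLength_lt_of_fixed hn hu h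
  have h2 := parity_mul hn (R k l δ) (R i j ε * w)
  have h3 := parity_mul hn (R i j ε) w
  have h4 := reflectionLength_mul_le hn (R i j ε * R k l δ) (R k l δ * (R i j ε * w))
  have h5 := reflectionLength_mul_le hn (R i j ε) (R k l δ)
  have e : R i j ε * R k l δ * (R k l δ * (R i j ε * w)) = w := by
    rw [mul_assoc, ← mul_assoc (R k l δ) (R k l δ), R_mul_self, one_mul, ← mul_assoc, R_mul_self,
      one_mul]
  rw [e] at h4
  rw [reflectionLength_R hn hij] at h3 h5
  rw [reflectionLength_R hn hkl] at h2 h5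
  exact ⟨⟨_, e.symm, by omega⟩, by omega⟩

end Length

/-! ### Generators and relations of the interval group -/

section IntervalGroup

variable {n : ℕ} {w : WD n}

lemma conj_mem_reflectionsD (hn : 2 ≤ n) {t : WD n} (ht : t ∈ reflectionsD n) (g : WD n) :
    g * t * g⁻¹ ∈ reflectionsD n := by
  obtain ⟨i, j, ε, hij, rfl⟩ := (mem_reflectionsD hn).1 ht
  rw [conj_R]
  exact (mem_reflectionsD hn).2 ⟨_, _, _, fun h => hij ((prm g).injective h), rfl⟩

lemma mul_self_of_mem_reflectionsD (hn : 2 ≤ n) {t : WD n} (ht : t ∈ reflectionsD n) :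
    t * t = 1 := by
  obtain ⟨i, j, ε, hij, rfl⟩ := (mem_reflectionsD hn).1 ht
  exact R_mul_self i j ε

lemma inv_of_mem_reflectionsD (hn : 2 ≤ n) {t : WD n} (ht : t ∈ reflectionsD n) :
    t⁻¹ = t :=
  inv_eq_of_mul_eq_one_left (mul_self_of_mem_reflectionsD hn ht)

lemma conj_mem_reflectionsD' (hn : 2 ≤ n) {s t : WD n} (hs : s ∈ reflectionsD n)
    (ht : t ∈ reflectionsD n) : s * t * s ∈ reflectionsD n := by
  have h := conj_mem_reflectionsD hn ht s
  rwa [inv_of_mem_reflectionsD hn hs] at h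

lemma mem_interval_of_mem_reflectionsD (hn : 2 ≤ n)
    (hw : reflectionLength (reflectionsD n) w = n) {t : WD n} (ht : t ∈ reflectionsD n) :
    t ∈ interval (reflectionsD n) w := by
  obtain ⟨i, j, ε, hij, rfl⟩ := (mem_reflectionsD hn).1 ht
  exact R_mem_interval hn hw hij ε

lemma reflectionLength_of_mem_reflectionsD (hn : 2 ≤ n) {t : WD n} (ht : t ∈ reflectionsD n) :
    reflectionLength (reflectionsD n) t = 1 := by
  obtain ⟨i, j, ε, hij, rfl⟩ := (mem_reflectionsD hn).1 ht
  exact reflectionLength_R hn hij ε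

open Classical in
/-- The generator of the interval group attached to `x`; by convention it is `1` when `x` is not in the
interval. -/
noncomputable def tau (w x : WD n) : IntervalGroup (reflectionsD n) w :=
  if h : x ∈ interval (reflectionsD n) w then gen (reflectionsD n) w ⟨x, h⟩ else 1

lemma tau_eq_gen {x : WD n} (h : x ∈ interval (reflectionsD n) w) :
    tau w x = gen (reflectionsD n) w ⟨x, h⟩ := dif_pos h

lemma tau_mul {u v : WD n} (hu : u ∈ interval (reflectionsD n) w)
    (hv : v ∈ interval (reflectionsD n) w) (huv : u * v ∈ interval (reflectionsD n) w)
    (hl : reflectionLength (reflectionsD n) (u * v) =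
      reflectionLength (reflectionsD n) u + reflectionLength (reflectionsD n) v) :
    tau w u * tau w v = tau w (u * v) := by
  rw [tau_eq_gen hu, tau_eq_gen hv, tau_eq_gen huv]
  have h := PresentedGroup.one_of_mem (rels := intervalRelators (reflectionsD n) w)
    (x := FreeGroup.of ⟨u, hu⟩ * FreeGroup.of ⟨v, hv⟩ * (FreeGroup.of ⟨u * v, huv⟩)⁻¹)
    ⟨⟨u, hu⟩, ⟨v, hv⟩, ⟨u * v, huv⟩, rfl, hl, rfl⟩
  rw [map_mul, map_mul, map_inv] at h
  exact mul_inv_eq_one.1 h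

/-- The product `t t'` of two reflections is a reduced decomposition of an element of `[1, w]`. -/
def Compat (w t t' : WD n) : Prop :=
  t * t' ∈ interval (reflectionsD n) w ∧ reflectionLength (reflectionsD n) (t * t') = 2

/-- The dual braid relations: two reflections whose product is a reduced decomposition of an element of
`[1, w]` can be exchanged in the interval group, at the price of conjugating one of them. -/
lemma Compat.tau_mul_left (hn : 2 ≤ n) (hw : reflectionLength (reflectionsD n) w = n)
    {t t' : WD n} (ht : t ∈ reflectionsD n) (ht' : t' ∈ reflectionsD n) (h : Compat w t t') :
    tau w t * tau w t' = tau w (t * t' * t) * tau w t := by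
  have h1 := conj_mem_reflectionsD' hn ht ht'
  have e : t * t' * t * t = t * t' := by
    rw [mul_assoc, mul_self_of_mem_reflectionsD hn ht, mul_one]
  rw [tau_mul (mem_interval_of_mem_reflectionsD hn hw ht)
    (mem_interval_of_mem_reflectionsD hn hw ht') h.1, tau_mul
    (mem_interval_of_mem_reflectionsD hn hw h1) (mem_interval_of_mem_reflectionsD hn hw ht), e]
  · rw [e]; exact h.1
  · rw [e, h.2, reflectionLength_of_mem_reflectionsD hn h1,
      reflectionLength_of_mem_reflectionsD hn ht]
  · rw [h.2, reflectionLength_of_mem_reflectionsD hn ht,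
      reflectionLength_of_mem_reflectionsD hn ht']

lemma Compat.tau_mul_right (hn : 2 ≤ n) (hw : reflectionLength (reflectionsD n) w = n)
    {t t' : WD n} (ht : t ∈ reflectionsD n) (ht' : t' ∈ reflectionsD n) (h : Compat w t t') :
    tau w t * tau w t' = tau w t' * tau w (t' * t * t') := by
  have h1 := conj_mem_reflectionsD' hn ht' ht
  have e : t' * (t' * t * t') = t * t' := by
    rw [mul_assoc, ← mul_assoc, mul_self_of_mem_reflectionsD hn ht', one_mul]
  rw [tau_mul (mem_interval_of_mem_reflectionsD hn hw ht)
    (mem_interval_of_mem_reflectionsD hn hw ht') h.1, tau_mul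
    (mem_interval_of_mem_reflectionsD hn hw ht') (mem_interval_of_mem_reflectionsD hn hw h1), e]
  · rw [e]; exact h.1
  · rw [e, h.2, reflectionLength_of_mem_reflectionsD hn h1,
      reflectionLength_of_mem_reflectionsD hn ht']
  · rw [h.2, reflectionLength_of_mem_reflectionsD hn ht,
      reflectionLength_of_mem_reflectionsD hn ht']

variable (w) in
/-- The canonical homomorphism from the interval group to `W(D_n)`. -/
def proj : IntervalGroup (reflectionsD n) w →* WD n :=
  PresentedGroup.toGroup (rels := intervalRelators (reflectionsD n) w)
    (f := fun x : interval (reflectionsD n) w => (x : WD n)) (by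
    rintro _ ⟨u, v, r, h, -, rfl⟩
    simp [h])

lemma proj_tau {x : WD n} (h : x ∈ interval (reflectionsD n) w) : proj w (tau w x) = x := by
  rw [tau_eq_gen h]
  exact PresentedGroup.toGroup.of _

/-- The reflections generate the interval group. -/
lemma closure_tau (hn : 2 ≤ n) (hw : reflectionLength (reflectionsD n) w = n) :
    Subgroup.closure (tau w '' reflectionsD n) = ⊤ := by
  have key : ∀ k : ℕ, ∀ x ∈ interval (reflectionsD n) w,
      reflectionLength (reflectionsD n) x = k →
        tau w x ∈ Subgroup.closure (tau w '' reflectionsD n) := by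
    intro k
    induction k with
    | zero =>
      intro x hx h0
      have hx1 := eq_one_of_reflectionLength_eq_zero hn h0
      subst hx1
      have h := tau_mul (w := w) hx hx (by simpa using hx) (by simp [h0])
      rw [mul_one] at h
      rw [mul_eq_left.1 h]
      exact one_mem _
    | succ k ih =>
      intro x hx hk
      obtain ⟨l, h1, h2, h3⟩ := exists_reduced hn x
      rw [hk] at h3
      have hl : l ≠ [] := by rintro rfl; simp at h3
      set y := l.dropLast.prod with hy
      set t := l.getLast hl with ht
      have hxy : y * t = x := by
        rw [← h2, ← List.dropLast_append_getLast hl, List.prod_append]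
        simp [y, t]
      have htT : t ∈ reflectionsD n := h1 _ (List.getLast_mem hl)
      have hyl : reflectionLength (reflectionsD n) y ≤ k := by
        refine (reflectionLength_le_of_list (l := l.dropLast)
          (fun s hs => h1 s (List.mem_of_mem_dropLast hs)) rfl).trans ?_
        rw [List.length_dropLast, h3]; omega
      have htl := reflectionLength_of_mem_reflectionsD hn htT
      have h4 := reflectionLength_mul_le hn y t
      rw [hxy, htl, hk] at h4
      obtain ⟨z, hz, hzl⟩ := hx
      have hyI : y ∈ interval (reflectionsD n) w := by
        refine ⟨t * z, by rw [← mul_assoc, hxy, hz], ?_⟩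
        have h5 := reflectionLength_mul_le hn t z
        have h6 := reflectionLength_mul_le hn y (t * z)
        rw [← mul_assoc, hxy, ← hz] at h6
        omega
      have htI := mem_interval_of_mem_reflectionsD hn hw htT
      rw [← hxy, ← tau_mul hyI htI (by rw [hxy]; exact ⟨z, hz, hzl⟩) (by rw [hxy]; omega)]
      exact mul_mem (ih y hyI (by omega)) (Subgroup.subset_closure ⟨t, htT, rfl⟩)
  rw [eq_top_iff, ← PresentedGroup.closure_range_of, Subgroup.closure_le]
  rintro _ ⟨x, rfl⟩
  have h := key _ x x.2 rfl
  rwa [tau_eq_gen x.2] at h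

end IntervalGroup

/-! ### The cycles of an element of maximal reflection length -/

section Cycles

variable {n : ℕ} {w : WD n}

/-- An element of maximal reflection length has no eigenvalue `1`, so `1 - w` is invertible. -/
lemma exists_act_eq_sub (hn : 2 ≤ n) (hw : reflectionLength (reflectionsD n) w = n)
    (a : Fin n → ℚ) : ∃ u, act w u = u - a := by
  let f : (Fin n → ℚ) →ₗ[ℚ] (Fin n → ℚ) :=
    { toFun := fun v => v - act w v
      map_add' := fun u v => by rw [act_add]; abel
      map_smul' := fun c v => by rw [act_smul, smul_sub]; rfl }
  have hinj : Function.Injective f := by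
    rw [← LinearMap.ker_eq_bot, LinearMap.ker_eq_bot']
    intro v hv
    exact eq_zero_of_act_eq hn hw (sub_eq_zero.1 hv).symm
  obtain ⟨u, hu⟩ := LinearMap.injective_iff_surjective.1 hinj a
  refine ⟨u, ?_⟩
  rw [← hu]
  change act w u = u - (u - act w u)
  abel

/-- The family `H i = (1 - w)⁻¹ e_i`. -/
def IsCayley (w : WD n) (H : Fin n → Fin n → ℚ) : Prop :=
  ∀ i, act w (H i) = H i - Pi.single i 1

lemma exists_isCayley (hn : 2 ≤ n) (hw : reflectionLength (reflectionsD n) w = n) :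
    ∃ H, IsCayley w H :=
  ⟨_, fun i => (exists_act_eq_sub hn hw (Pi.single i 1)).choose_spec⟩

variable {H : Fin n → Fin n → ℚ}

lemma IsCayley.add_eq (hH : IsCayley w H) (i j : Fin n) :
    H i j + H j i = if i = j then 1 else 0 := by
  have h := act_dot w (H i) (H j)
  rw [hH i, hH j] at h
  simp only [sub_dotProduct, dotProduct_sub, dotProduct_single, single_dotProduct, mul_one,
    one_mul] at h
  by_cases hij : i = j
  · simp [hij] at h ⊢; linarith
  · simp [hij] at h ⊢; linarith

lemma IsCayley.self (hH : IsCayley w H) (i : Fin n) : H i i = 1 / 2 := by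
  have h := hH.add_eq i i
  simp at h
  linarith

lemma IsCayley.antisymm (hH : IsCayley w H) {i j : Fin n} (hij : i ≠ j) :
    H j i = - H i j := by
  have h := hH.add_eq i j
  simp [hij] at h
  linarith

lemma IsCayley.apply_prm (hH : IsCayley w H) {i j : Fin n} (hij : prm w j ≠ i) :
    H i (prm w j) = ((sgn w (prm w j) : ℤ) : ℚ) * H i j := by
  have h := congrFun (hH i) (prm w j)
  simp only [act, Pi.sub_apply, Pi.single_eq_of_ne hij, sub_zero] at h
  rw [← h]
  simp

lemma IsCayley.of_sameCycle (hH : IsCayley w H) {i j : Fin n} (hij : (prm w).SameCycle i j) :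
    H i j = 1 / 2 ∨ H i j = -(1 / 2) := by
  obtain ⟨k, -, rfl⟩ := hij.exists_pow_eq'
  induction k with
  | zero => left; simpa using hH.self i
  | succ k ih =>
    by_cases h : ((prm w) ^ (k + 1)) i = i
    · rw [h]; left; exact hH.self i
    · rw [pow_succ', Equiv.Perm.mul_apply] at h ⊢
      rw [hH.apply_prm h]
      have ih' := ih ⟨k, rfl⟩
      rcases Int.units_eq_one_or (sgn w ((prm w) ((prm w ^ k) i))) with h1 | h1 <;>
        rcases ih' with h2 | h2 <;> rw [h1, h2] <;> norm_num

lemma IsCayley.of_not_sameCycle (hn : 2 ≤ n) (hw : reflectionLength (reflectionsD n) w = n)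
    (hH : IsCayley w H) {i j : Fin n} (hij : ¬ (prm w).SameCycle i j) : H i j = 0 := by
  classical
  -- the part of `H i` off the cycle of `i` is fixed by `w`
  let v : Fin n → ℚ := fun k => if (prm w).SameCycle i k then 0 else H i k
  have hv : act w v = v := by
    funext k
    obtain ⟨k, rfl⟩ := (prm w).surjective k
    have e : (prm w)⁻¹ (prm w k) = k := by simp
    simp only [act, v, e, Equiv.Perm.sameCycle_apply_right]
    by_cases h : (prm w).SameCycle i k
    · simp [h]
    · have hne : prm w k ≠ i := fun e => h (by
        have h1 : (prm w).SameCycle i (prm w k) := by rw [e]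
        rwa [Equiv.Perm.sameCycle_apply_right] at h1)
      simp [h, hH.apply_prm hne]
  have h0 := congrFun (eq_zero_of_act_eq hn hw hv) j
  simpa [v, hij] using h0

lemma IsCayley.act_sub_smul (hH : IsCayley w H) (i j : Fin n) (ε : ℤˣ) :
    act w (H i - ((ε : ℤ) : ℚ) • H j) = H i - ((ε : ℤ) : ℚ) • H j - root i j ε := by
  rw [act_sub, act_smul, hH i, hH j, smul_sub, root]
  have : ((ε : ℤ) : ℚ) • (Pi.single j 1 : Fin n → ℚ) = Pi.single j ((ε : ℤ) : ℚ) := by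
    rw [← Pi.single_smul]; simp
  rw [this]; abel

/-- A product of two reflections is a reduced decomposition of an element of `[1, w]` as soon as the
bilinear form `(u, v) ↦ ⟨(1 - w)⁻¹ u, v⟩` vanishes on the two roots. -/
lemma IsCayley.compat (hn : 2 ≤ n) (hw : reflectionLength (reflectionsD n) w = n)
    (hH : IsCayley w H) {i j k l : Fin n} (hij : i ≠ j) (hkl : k ≠ l) (ε δ : ℤˣ)
    (h : H i k - ((ε : ℤ) : ℚ) * H j k = ((δ : ℤ) : ℚ) * (H i l - ((ε : ℤ) : ℚ) * H j l)) :
    Compat w (R i j ε) (R k l δ) := by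
  have hu := hH.act_sub_smul i j ε
  set u := H i - ((ε : ℤ) : ℚ) • H j with hu_def
  have h1 : u ⬝ᵥ root i j ε = 1 := by
    have h2 := act_dot w u u
    rw [hu] at h2
    simp only [sub_dotProduct, dotProduct_sub, root_dot_self hij,
      dotProduct_comm (root i j ε) u] at h2
    linarith
  refine R_mul_R_mem_interval hn hw hij hkl (u := u) ?_ ?_
  · intro h0
    rw [h0] at h1
    simp at h1
  · have h2 : act (R i j ε) (act w u) = u := by
      rw [hu, act_R hij, sub_dotProduct, h1, root_dot_self hij]
      funext k
      simp
      ring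
    rw [act_mul, act_mul, h2]
    refine act_R_of_dot_eq_zero hkl δ ?_
    rw [dot_root]
    simp only [hu_def, Pi.sub_apply, Pi.smul_apply, smul_eq_mul]
    linarith

/-- The product of the signs of `w` being `1`, it cannot be a single negative cycle. -/
lemma exists_not_sameCycle (hn : 2 ≤ n) (hw : reflectionLength (reflectionsD n) w = n)
    (i : Fin n) : ∃ j, ¬ (prm w).SameCycle i j := by
  by_contra hcon
  push Not at hcon
  obtain ⟨H, hH⟩ := exists_isCayley hn hw
  have hne : ∀ j, H i j ≠ 0 := fun j => by
    rcases hH.of_sameCycle (hcon j) with h | h <;> rw [h] <;> norm_num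
  have h1 : ∀ j, ((sgn w j : ℤ) : ℚ) * H i ((prm w)⁻¹ j) = (if j = i then -1 else 1) * H i j := by
    intro j
    have h := congrFun (hH i) j
    simp only [act, Pi.sub_apply] at h
    rw [h]
    by_cases hj : j = i
    · subst hj; simp [hH.self]; norm_num
    · simp [hj]
  have h2 := Finset.prod_congr (rfl : (Finset.univ : Finset (Fin n)) = Finset.univ)
    fun j _ => h1 j
  rw [Finset.prod_mul_distrib, Finset.prod_mul_distrib, Equiv.prod_comp (prm w)⁻¹ (H i)] at h2
  have h3 := mul_right_cancel₀ (Finset.prod_ne_zero_iff.2 fun j _ => hne j) h2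
  have h4 : ∏ j, ((sgn w j : ℤ) : ℚ) = 1 := by
    have := congrArg (fun z : ℤˣ => ((z : ℤ) : ℚ)) (prod_sgn w)
    simpa using this
  rw [h4] at h3
  simp at h3
  norm_num at h3

/-! ### Roots of reflections -/

open Classical in
/-- A root of the reflection `t`; by convention it is `0` if `t` is not a reflection. -/
noncomputable def rootOf (t : WD n) : Fin n → ℚ :=
  if h : ∃ i j ε, i ≠ j ∧ t = R i j ε then
    root h.choose h.choose_spec.choose h.choose_spec.choose_spec.choose
  else 0

lemma exists_rootOf_eq (hn : 2 ≤ n) {t : WD n} (ht : t ∈ reflectionsD n) :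
    ∃ i j ε, i ≠ j ∧ t = R i j ε ∧ rootOf t = root i j ε := by
  have h := (mem_reflectionsD hn).1 ht
  exact ⟨_, _, _, h.choose_spec.choose_spec.choose_spec.1,
    h.choose_spec.choose_spec.choose_spec.2, dif_pos h⟩

lemma act_rootOf (hn : 2 ≤ n) {t : WD n} (ht : t ∈ reflectionsD n) (v : Fin n → ℚ) :
    act t v = v - (v ⬝ᵥ rootOf t) • rootOf t := by
  obtain ⟨i, j, ε, hij, rfl, hr⟩ := exists_rootOf_eq hn ht
  rw [hr, act_R hij]

lemma rootOf_dot_self (hn : 2 ≤ n) {t : WD n} (ht : t ∈ reflectionsD n) :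
    rootOf t ⬝ᵥ rootOf t = 2 := by
  obtain ⟨i, j, ε, hij, rfl, hr⟩ := exists_rootOf_eq hn ht
  rw [hr, root_dot_self hij]

/-- The vectors whose coordinates are integers. -/
def integralVectors (n : ℕ) : AddSubgroup (Fin n → ℚ) where
  carrier := {v | ∀ i, ∃ z : ℤ, v i = z}
  zero_mem' := fun i => ⟨0, by simp⟩
  add_mem' := fun {u v} hu hv i => by
    obtain ⟨a, ha⟩ := hu i
    obtain ⟨b, hb⟩ := hv i
    exact ⟨a + b, by simp [ha, hb]⟩
  neg_mem' := fun {u} hu i => by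
    obtain ⟨a, ha⟩ := hu i
    exact ⟨-a, by simp [ha]⟩

lemma root_mem_integralVectors (i j : Fin n) (ε : ℤˣ) : root i j ε ∈ integralVectors n := by
  intro k
  refine ⟨(Pi.single i 1 - Pi.single j (ε : ℤ) : Fin n → ℤ) k, ?_⟩
  simp only [root, Pi.sub_apply, Pi.single_apply]
  split_ifs <;> simp

lemma rootOf_mem_integralVectors (hn : 2 ≤ n) {t : WD n} (ht : t ∈ reflectionsD n) :
    rootOf t ∈ integralVectors n := by
  obtain ⟨i, j, ε, hij, rfl, hr⟩ := exists_rootOf_eq hn ht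
  rw [hr]; exact root_mem_integralVectors i j ε

lemma exists_int_dot_rootOf (hn : 2 ≤ n) {t : WD n} (ht : t ∈ reflectionsD n) {v : Fin n → ℚ}
    (hv : v ∈ integralVectors n) : ∃ z : ℤ, v ⬝ᵥ rootOf t = z := by
  obtain ⟨i, j, ε, hij, rfl, hr⟩ := exists_rootOf_eq hn ht
  obtain ⟨a, ha⟩ := hv i
  obtain ⟨b, hb⟩ := hv j
  exact ⟨a - ε * b, by rw [hr, dot_root, ha, hb]; push_cast; ring⟩

lemma linearIndependent_of_forall_dot {ρ : Fin n → Fin n → ℚ}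
    (h : ∀ v, (∀ k, ρ k ⬝ᵥ v = 0) → v = 0) : LinearIndependent ℚ ρ := by
  have h1 : IsUnit (Matrix.of ρ) := by
    rw [← Matrix.mulVec_injective_iff_isUnit]
    intro u v huv
    refine sub_eq_zero.1 (h _ fun k => ?_)
    rw [dotProduct_sub, sub_eq_zero]
    exact congrFun huv k
  exact Matrix.linearIndependent_rows_iff_isUnit.2 h1

/-- If the roots of a product `t_1 ⋯ t_k` of reflections are linearly independent and `(1 - t_1 ⋯ t_k) u`
is an integral combination of them, then `u` has integral products with these roots. -/
lemma exists_int_dot_of_sub_mem (hn : 2 ≤ n) (u : Fin n → ℚ) : ∀ l : List (WD n),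
    (∀ t ∈ l, t ∈ reflectionsD n) →
    LinearIndependent ℚ (fun k : Fin l.length => rootOf (l.get k)) →
    u - act l.prod u ∈ AddSubgroup.closure (rootOf '' {t | t ∈ l}) →
    ∀ t ∈ l, ∃ z : ℤ, u ⬝ᵥ rootOf t = z := by
  have hint : ∀ l : List (WD n), (∀ t ∈ l, t ∈ reflectionsD n) →
      AddSubgroup.closure (rootOf '' {t | t ∈ l}) ≤ integralVectors n := by
    intro l hl
    rw [AddSubgroup.closure_le]
    rintro _ ⟨t, ht, rfl⟩
    exact rootOf_mem_integralVectors hn (hl t ht)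
  have hspan : ∀ l : List (WD n), (∀ t ∈ l, t ∈ reflectionsD n) → u - act l.prod u ∈
      Submodule.span ℚ (rootOf '' {t | t ∈ l}) := by
    intro l
    induction l with
    | nil => intro _; simp [act_one]
    | cons t l ih =>
      intro hl
      have h1 := ih fun s hs => hl s (List.mem_cons_of_mem _ hs)
      rw [List.prod_cons, act_mul, act_rootOf hn (hl t List.mem_cons_self), ← sub_add]
      refine add_mem (Submodule.span_mono (Set.image_mono ?_) h1)
        (Submodule.smul_mem _ _ (Submodule.subset_span ⟨t, by simp, rfl⟩))
      intro s hs
      exact List.mem_cons_of_mem _ hs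
  intro l
  induction l with
  | nil => intro _ _ _ t ht; simp at ht
  | cons t l ih =>
    intro hl hli hmem
    have hl' : ∀ s ∈ l, s ∈ reflectionsD n := fun s hs => hl s (List.mem_cons_of_mem _ hs)
    have htT := hl t List.mem_cons_self
    have hli' : LinearIndependent ℚ (fun k : Fin l.length => rootOf (l.get k)) ∧
        rootOf t ∉ Submodule.span ℚ (Set.range fun k : Fin l.length => rootOf (l.get k)) :=
      linearIndependent_finSucc.1 hli
    have hrange : (Set.range fun k : Fin l.length => rootOf (l.get k)) =
        rootOf '' {s | s ∈ l} := by
      ext v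
      constructor
      · rintro ⟨k, rfl⟩; exact ⟨_, List.get_mem _ _, rfl⟩
      · rintro ⟨s, hs, rfl⟩
        obtain ⟨k, hk⟩ := List.get_of_mem hs
        exact ⟨k, by simp only [hk]⟩
    rw [hrange] at hli'
    have hset : {s | s ∈ t :: l} = insert t {s | s ∈ l} := by ext s; simp
    rw [hset, Set.image_insert_eq, Set.insert_eq, AddSubgroup.closure_union] at hmem
    obtain ⟨a, ha, b, hb, hab⟩ := AddSubgroup.mem_sup.1 hmem
    obtain ⟨z, rfl⟩ := AddSubgroup.mem_closure_singleton.1 ha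
    rw [List.prod_cons, act_mul, act_rootOf hn htT, ← sub_add] at hab
    set d := act l.prod u ⬝ᵥ rootOf t with hd
    have hbspan : b ∈ Submodule.span ℚ (rootOf '' {s | s ∈ l}) :=
      (AddSubgroup.closure_le (K := (Submodule.span ℚ
        (rootOf '' {s | s ∈ l})).toAddSubgroup)).2 Submodule.subset_span hb
    have hdz : d = z := by
      by_contra hne
      apply hli'.2
      have h1 : (d - z) • rootOf t ∈ Submodule.span ℚ (rootOf '' {s | s ∈ l}) := by
        have h2 : (d - z) • rootOf t = b - (u - act l.prod u) := by
          rw [sub_smul, Int.cast_smul_eq_zsmul, eq_sub_iff_add_eq, ← sub_eq_zero]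
          rw [← sub_eq_zero] at hab
          rw [← neg_eq_zero, ← hab]
          abel
        rw [h2]
        exact sub_mem hbspan (hspan l hl')
      exact (Submodule.smul_mem_iff _ (sub_ne_zero.2 hne)).1 h1
    have hb' : u - act l.prod u = b := by
      rw [hdz, Int.cast_smul_eq_zsmul, add_comm] at hab
      exact (add_right_cancel hab).symm
    have ih' := ih hl' hli'.1 (hb' ▸ hb)
    intro s hs
    rcases List.mem_cons.1 hs with rfl | hs
    · obtain ⟨y, hy⟩ := exists_int_dot_rootOf hn htT (hint l hl' hb)
      refine ⟨z + y, ?_⟩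
      rw [← hb', sub_dotProduct, ← hd, hdz] at hy
      push_cast
      linarith
    · exact ih' s hs

end Cycles

section TwoCycles

variable {n : ℕ} {w : WD n}

/-- A quasi-Coxeter element has at most two cycles: otherwise `(1 - w)⁻¹` would not be integral on
roots, although `w` is a product of `n` reflections whose roots span the root lattice. -/
lemma sameCycle_of_not_sameCycle (hn : 2 ≤ n)
    (hw : reflectionLength (reflectionsD n) w = n) (hq : IsQuasiCoxeter (reflectionsD n) w)
    {a b c : Fin n} (hab : ¬ (prm w).SameCycle a b) (hac : ¬ (prm w).SameCycle a c) :
    (prm w).SameCycle b c := by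
  by_contra hbc
  obtain ⟨H, hH⟩ := exists_isCayley hn hw
  obtain ⟨l, ⟨hl, hprod, hlen⟩, hgen⟩ := hq
  rw [hw] at hlen
  have hli : LinearIndependent ℚ (fun k : Fin l.length => rootOf (l.get k)) := by
    rw [← linearIndependent_equiv (finCongr hlen.symm)]
    refine linearIndependent_of_forall_dot fun v hv => eq_zero_of_act_eq hn hw ?_
    rw [← hprod]
    refine act_list_prod_of_fixed fun t ht => ?_
    obtain ⟨k, rfl⟩ := List.get_of_mem ht
    have h := hv (finCongr hlen k)
    rw [act_rootOf hn (hl _ ht), dotProduct_comm]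
    simp only [Function.comp_apply, finCongr_apply] at h
    have e : Fin.cast hlen.symm (Fin.cast hlen k) = k := rfl
    rw [e] at h
    rw [h]; simp
  set L := AddSubgroup.closure (rootOf '' {t | t ∈ l}) with hL
  have hLint : L ≤ integralVectors n := by
    rw [hL, AddSubgroup.closure_le]
    rintro _ ⟨t, ht, rfl⟩
    exact rootOf_mem_integralVectors hn (hl t ht)
  -- the lattice spanned by the roots of the factors is invariant under the group
  have hstab1 : ∀ t ∈ l, ∀ v ∈ L, act t v ∈ L := by
    intro t ht v hv
    obtain ⟨z, hz⟩ := exists_int_dot_rootOf hn (hl t ht) (hLint hv)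
    rw [act_rootOf hn (hl t ht), hz, Int.cast_smul_eq_zsmul]
    exact sub_mem hv (zsmul_mem (AddSubgroup.subset_closure (Set.mem_image_of_mem rootOf ht)) z)
  have hstab : ∀ g : WD n, ∀ v, v ∈ L → act g v ∈ L := by
    intro g
    have hg : g ∈ Subgroup.closure {t | t ∈ l} := by rw [hgen]; trivial
    have hg2 : ∀ v, v ∈ L ↔ act g v ∈ L := by
      induction hg using Subgroup.closure_induction with
      | mem t ht =>
        intro v
        refine ⟨hstab1 t ht v, fun h => ?_⟩
        have h2 := hstab1 t ht _ h
        rwa [← act_mul, mul_self_of_mem_reflectionsD hn (hl t ht), act_one] at h2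
      | one => intro v; rw [act_one]
      | mul x y _ _ hx hy => intro v; rw [act_mul, ← hx, ← hy]
      | inv x _ hx => intro v; rw [hx (act x⁻¹ v), ← act_mul, mul_inv_cancel, act_one]
    exact fun v => (hg2 v).1
  have hl0 : l ≠ [] := by rintro rfl; simp at hlen; omega
  obtain ⟨i, j, ε, hij, -, hr⟩ := exists_rootOf_eq hn (hl _ (List.head_mem hl0))
  have hroots : ∀ p q, p ≠ q → root p q ε ∈ L := by
    intro p q hpq
    obtain ⟨σ, h1, h2⟩ := exists_perm_pair hij hpq
    have h := hstab (ofPerm σ) (root i j ε) (by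
      rw [← hr]; exact AddSubgroup.subset_closure (Set.mem_image_of_mem rootOf (List.head_mem hl0)))
    have e : ∀ k, sgn (ofPerm σ) k = 1 := fun k => rfl
    have e2 : prm (ofPerm σ) = σ := rfl
    rwa [root, act_sub, act_single, act_single, e, e, e2, h1, h2, Units.val_one, Int.cast_one,
      one_mul, one_mul] at h
  have hne : ∀ {x y}, ¬ (prm w).SameCycle x y → x ≠ y := by
    rintro x y h rfl; exact h (Equiv.Perm.SameCycle.refl _ _)
  set u := H a - ((ε : ℤ) : ℚ) • H b with hu
  have hint := exists_int_dot_of_sub_mem hn u l hl hli (by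
    rw [hprod, hH.act_sub_smul, sub_sub_cancel]
    exact hroots a b (hne hab))
  have hint2 : ∀ v ∈ L, ∃ z : ℤ, u ⬝ᵥ v = z := by
    intro v hv
    induction hv using AddSubgroup.closure_induction with
    | mem v hv => obtain ⟨t, ht, rfl⟩ := hv; exact hint t ht
    | zero => exact ⟨0, by simp⟩
    | add x y _ _ hx hy =>
      obtain ⟨a, ha⟩ := hx
      obtain ⟨b, hb⟩ := hy
      exact ⟨a + b, by rw [dotProduct_add, ha, hb]; push_cast; rfl⟩
    | neg x _ hx =>
      obtain ⟨a, ha⟩ := hx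
      exact ⟨-a, by rw [dotProduct_neg, ha]; push_cast; rfl⟩
  obtain ⟨z, hz⟩ := hint2 _ (hroots a c (hne hac))
  rw [dot_root] at hz
  simp only [hu, Pi.sub_apply, Pi.smul_apply, smul_eq_mul, hH.self,
    hH.of_not_sameCycle hn hw hac, hH.of_not_sameCycle hn hw hbc,
    hH.of_not_sameCycle hn hw (fun h => hab h.symm)] at hz
  have h2 : (1 : ℚ) = ((2 * z : ℤ) : ℚ) := by push_cast; linarith
  have h3 : (1 : ℤ) = 2 * z := by exact_mod_cast h2
  omega

/-! ### Carter decompositions -/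

lemma dot_rootOf_eq_zero_iff_commute (hn : 2 ≤ n) {t t' : WD n} (ht : t ∈ reflectionsD n)
    (ht' : t' ∈ reflectionsD n) (hne : t ≠ t') :
    rootOf t ⬝ᵥ rootOf t' = 0 ↔ Commute t t' := by
  constructor
  · intro h
    refine act_injective fun v => ?_
    rw [act_mul, act_mul, act_rootOf hn ht, act_rootOf hn ht', act_rootOf hn ht',
      act_rootOf hn ht]
    simp only [sub_dotProduct, smul_dotProduct, h, dotProduct_comm (rootOf t') (rootOf t),
      smul_zero, sub_zero]
    abel
  · intro h
    by_contra hd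
    have h1 : ∀ v, (v ⬝ᵥ rootOf t') • rootOf t = (v ⬝ᵥ rootOf t) • rootOf t' := by
      intro v
      have h2 : act t (act t' v) = act t' (act t v) := by rw [← act_mul, ← act_mul, h.eq]
      rw [act_rootOf hn ht, act_rootOf hn ht', act_rootOf hn ht', act_rootOf hn ht] at h2
      simp only [sub_dotProduct, smul_dotProduct, dotProduct_comm (rootOf t') (rootOf t),
        smul_eq_mul] at h2
      refine smul_right_injective _ hd ?_
      funext k
      have h3 := congrFun h2 k
      simp only [Pi.sub_apply, Pi.smul_apply, smul_eq_mul] at h3 ⊢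
      linarith
    have h2 := h1 (rootOf t)
    rw [rootOf_dot_self hn ht] at h2
    set c := rootOf t ⬝ᵥ rootOf t' with hc
    have h3 : c * c = 4 := by
      have h4 := congrArg (fun v => v ⬝ᵥ rootOf t') h2
      simp only [smul_dotProduct, rootOf_dot_self hn ht', smul_eq_mul, ← hc] at h4
      linarith
    refine hne (act_injective fun v => ?_)
    have h5 : rootOf t' = (c / 2) • rootOf t := by
      funext k
      have h6 := congrFun h2 k
      simp only [Pi.smul_apply, smul_eq_mul] at h6 ⊢
      linarith
    rw [act_rootOf hn ht, act_rootOf hn ht', h5]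
    funext k
    simp only [dotProduct_smul, Pi.sub_apply, Pi.smul_apply, smul_eq_mul]
    linear_combination (v ⬝ᵥ rootOf t * rootOf t k / 4) * h3

/-- The product of a list of reflections with orthogonal roots. -/
lemma act_prod_of_pairwise (hn : 2 ≤ n) {s : Fin n → WD n} (hs : ∀ i, s i ∈ reflectionsD n) :
    ∀ l : List (Fin n), (l.Pairwise fun i j => rootOf (s i) ⬝ᵥ rootOf (s j) = 0) →
    ∀ v, act (l.map s).prod v =
      v - (l.map fun i => (v ⬝ᵥ rootOf (s i)) • rootOf (s i)).sum := by
  intro l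
  induction l with
  | nil => intro _ v; simp [act_one]
  | cons i l ih =>
    intro hl v
    rw [List.pairwise_cons] at hl
    have h0 : (l.map fun j => (v ⬝ᵥ rootOf (s j)) • rootOf (s j)).sum ⬝ᵥ rootOf (s i) = 0 := by
      have hl1 := hl.1
      clear hl ih
      induction l with
      | nil => simp
      | cons j l ih =>
        rw [List.map_cons, List.sum_cons, add_dotProduct, smul_dotProduct,
          dotProduct_comm (rootOf (s j)) (rootOf (s i)), hl1 j List.mem_cons_self, ih fun k hk => hl1 k (List.mem_cons_of_mem _ hk)]
        simp
    rw [List.map_cons, List.prod_cons, act_mul, ih hl.2, act_rootOf hn (hs i), List.map_cons,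
      List.sum_cons, sub_dotProduct, h0, sub_zero]
    abel

lemma exists_eq_smul_root {a b y : Fin n} {ε : ℤˣ} (hab : a ≠ b) (hy : root a b ε y ≠ 0) :
    ∃ z ε', ∃ σ : ℚ, y ≠ z ∧ σ * σ = 1 ∧ root a b ε = σ • root y z ε' := by
  by_cases h1 : y = a
  · subst h1; exact ⟨b, ε, 1, hab, by simp, by simp⟩
  · by_cases h2 : y = b
    · subst h2
      have hε := units_rat_mul_self ε
      refine ⟨a, ε, -((ε : ℤ) : ℚ), hab.symm, by simp [hε], ?_⟩
      funext k
      simp only [root, Pi.sub_apply, Pi.smul_apply, smul_eq_mul, Pi.single_apply]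
      split_ifs <;> linarith
    · exact absurd (by simp [root, h1, h2]) hy

/-- Two orthogonal roots which share a coordinate `y` are `± e_y ± e_z` for one and the same `z`. -/
lemma smul_add_smul_eq_of_dot_eq_zero {a b c d y : Fin n} {ε δ : ℤˣ} (hab : a ≠ b)
    (hcd : c ≠ d) (h : root a b ε ⬝ᵥ root c d δ = 0) (hy : root a b ε y ≠ 0)
    (hy' : root c d δ y ≠ 0) :
    root a b ε y • root a b ε + root c d δ y • root c d δ = Pi.single y 2 := by
  obtain ⟨z, ε', σ, hyz, hσ, h1⟩ := exists_eq_smul_root hab hy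
  obtain ⟨z', δ', τ, hyz', hτ, h2⟩ := exists_eq_smul_root hcd hy'
  have hσ0 : σ ≠ 0 := by rintro rfl; simp at hσ
  have hτ0 : τ ≠ 0 := by rintro rfl; simp at hτ
  rw [h1, h2] at h ⊢
  rw [smul_dotProduct, dotProduct_smul, smul_eq_mul, smul_eq_mul, mul_eq_zero, mul_eq_zero] at h
  have h3 := (h.resolve_left hσ0).resolve_left hτ0
  rw [dot_root] at h3
  have e1 : root y z ε' y = 1 := by simp [root, hyz]
  have e2 : root y z' δ' y = 1 := by simp [root, hyz']
  have hzz : z = z' := by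
    by_contra hne
    have : root y z ε' z' = 0 := by simp [root, hyz'.symm, Ne.symm hne]
    rw [e1, this] at h3
    simp at h3
  subst hzz
  have e3 : root y z ε' z = -((ε' : ℤ) : ℚ) := by simp [root, hyz.symm]
  rw [e1, e3] at h3
  simp only [Pi.smul_apply, smul_eq_mul, e1, e2, mul_one, smul_smul, hσ, hτ, one_smul]
  have h4 : ((δ' : ℤ) : ℚ) = -((ε' : ℤ) : ℚ) := by
    have := units_rat_mul_self ε'
    linear_combination ((ε' : ℤ) : ℚ) * h3 - ((δ' : ℤ) : ℚ) * this
  funext k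
  simp only [root, h4, Pi.add_apply, Pi.sub_apply, Pi.single_apply]
  split_ifs <;> norm_num

lemma carterDiagramD_adj {m : ℕ} (i j : Fin n) :
    (carterDiagramD m n).Adj i j ↔ (i : ℕ) ≠ j ∧
      (((1 ≤ (i : ℕ) ∧ (j : ℕ) = i + 1) ∨ ((i : ℕ) = 0 ∧ ((j : ℕ) + 1 = m ∨ (j : ℕ) + 1 = m + 2))) ∨
      ((1 ≤ (j : ℕ) ∧ (i : ℕ) = j + 1) ∨
        ((j : ℕ) = 0 ∧ ((i : ℕ) + 1 = m ∨ (i : ℕ) + 1 = m + 2)))) := by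
  rw [carterDiagramD, SimpleGraph.fromRel_adj, ne_eq, Fin.ext_iff]

/-- Any two distinct vertices of `Δ_{m,n}` with the same neighbours have two common neighbours, which are
not joined. -/
lemma exists_common_neighbours {m : ℕ} (hn : 4 ≤ n) (hm : 1 < m) (hmn : 2 * m ≤ n)
    {i j : Fin n} (hij : i ≠ j)
    (h : ∀ k, (carterDiagramD m n).Adj k i ↔ (carterDiagramD m n).Adj k j) :
    ∃ p q, p ≠ q ∧ (carterDiagramD m n).Adj p i ∧ (carterDiagramD m n).Adj q i ∧
      ¬ (carterDiagramD m n).Adj p q := by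
  have hij' : (i : ℕ) ≠ j := fun e => hij (Fin.ext e)
  have key : ∀ p q : ℕ, ∀ hp : p < n, ∀ hq : q < n, p ≠ q →
      (carterDiagramD m n).Adj ⟨p, hp⟩ i → (carterDiagramD m n).Adj ⟨q, hq⟩ i →
      ¬ (carterDiagramD m n).Adj ⟨p, hp⟩ ⟨q, hq⟩ →
      ∃ p q, p ≠ q ∧ (carterDiagramD m n).Adj p i ∧ (carterDiagramD m n).Adj q i ∧
        ¬ (carterDiagramD m n).Adj p q :=
    fun p q hp hq h1 h2 h3 h4 => ⟨⟨p, hp⟩, ⟨q, hq⟩, fun e => h1 (Fin.ext_iff.1 e), h2, h3, h4⟩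
  simp only [carterDiagramD_adj] at h key ⊢
  have hi := i.2
  have hj := j.2
  by_cases i0 : (i : ℕ) = 0
  · exact key (m - 1) (m + 1) (by omega) (by omega) (by omega) (by omega) (by omega) (by omega)
  by_cases i1 : (i : ℕ) = 1
  · by_cases hm2 : m = 2
    · exact key 0 2 (by omega) (by omega) (by omega) (by omega) (by omega) (by omega)
    · -- here `i` is a leaf, and no other vertex is joined to its neighbour only
      have h2 := (h ⟨2, by omega⟩).1 (by simp only; omega)
      have h4 := mt (h ⟨4, by omega⟩).2 (by simp only; omega)
      simp only at h2 h4
      omega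
  by_cases i2 : (i : ℕ) + 1 < n
  · exact key (i - 1) (i + 1) (by omega) (by omega) (by omega) (by omega) (by omega) (by omega)
  by_cases hn4 : n = 4
  · exact key 0 2 (by omega) (by omega) (by omega) (by omega) (by omega) (by omega)
  · have h2 := (h ⟨n - 2, by omega⟩).1 (by simp only; omega)
    have h4 := mt (h ⟨n - 4, by omega⟩).2 (by simp only; omega)
    simp only at h2 h4
    omega

lemma carterDiagramD_connected {m : ℕ} (hm : 1 < m) (hmn : 2 * m ≤ n)
    (P : Fin n → Prop) (hP : ∀ i j, (carterDiagramD m n).Adj i j → P i → P j) {i : Fin n}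
    (hi : P i) (j : Fin n) : P j := by
  have hiff : ∀ i j, (carterDiagramD m n).Adj i j → (P i ↔ P j) :=
    fun i j h => ⟨hP i j h, hP j i h.symm⟩
  have h1n : 1 < n := by omega
  have key : ∀ k : ℕ, ∀ hk : k + 1 < n, P ⟨k + 1, hk⟩ ↔ P ⟨1, h1n⟩ := by
    intro k
    induction k with
    | zero => intro _; rfl
    | succ k ih =>
      intro hk
      rw [← ih (by omega)]
      exact hiff _ _ (by rw [carterDiagramD_adj]; simp only [and_true]; omega)
  have key2 : ∀ k, P k ↔ P ⟨1, h1n⟩ := by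
    rintro ⟨k, hk⟩
    rcases k with _ | k
    · rw [← key (m - 2) (by omega)]
      exact hiff _ _ (by rw [carterDiagramD_adj]; simp only [true_and]; omega)
    · exact key k hk
  rw [key2] at hi ⊢
  exact hi

end TwoCycles

section Carter

variable {n m : ℕ} {w : WD n} {s : Fin n → WD n}

section

variable {Γ : SimpleGraph (Fin n)}

lemma IsCarterDecomposition.reflectionLength_eq
    (hs : IsCarterDecomposition (reflectionsD n) w Γ s) :
    reflectionLength (reflectionsD n) w = n := by
  obtain ⟨l₁, l₂, hp, -, -, -, -, hlen⟩ := hs.bipartite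
  rw [← hlen, List.length_map, hp.length_eq, List.length_finRange]

lemma IsCarterDecomposition.mem (hs : IsCarterDecomposition (reflectionsD n) w Γ s) (i : Fin n) :
    s i ∈ reflectionsD n := by
  obtain ⟨l₁, l₂, hp, -, -, hT, -, -⟩ := hs.bipartite
  exact hT _ (List.mem_map_of_mem (hp.mem_iff.2 (List.mem_finRange i)))

lemma IsCarterDecomposition.act_eq (hs : IsCarterDecomposition (reflectionsD n) w Γ s)
    {v : Fin n → ℚ} (h : ∀ i, act (s i) v = v) : act w v = v := by
  obtain ⟨l₁, l₂, -, -, -, -, hprod, -⟩ := hs.bipartite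
  rw [← hprod]
  refine act_list_prod_of_fixed fun t ht => ?_
  obtain ⟨i, -, rfl⟩ := List.mem_map.1 ht
  exact h i

lemma IsCarterDecomposition.eq_zero (hn : 2 ≤ n)
    (hs : IsCarterDecomposition (reflectionsD n) w Γ s) {v : Fin n → ℚ}
    (h : ∀ i, act (s i) v = v) : v = 0 :=
  eq_zero_of_act_eq hn hs.reflectionLength_eq (hs.act_eq h)

lemma IsCarterDecomposition.linearIndependent (hn : 2 ≤ n)
    (hs : IsCarterDecomposition (reflectionsD n) w Γ s) :
    LinearIndependent ℚ fun i => rootOf (s i) := by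
  refine linearIndependent_of_forall_dot fun v hv => hs.eq_zero hn fun i => ?_
  rw [act_rootOf hn (hs.mem i), dotProduct_comm, hv i, zero_smul, sub_zero]

lemma IsCarterDecomposition.injective
    (hs : IsCarterDecomposition (reflectionsD n) w Γ s) (hn : 2 ≤ n) {i j : Fin n}
    (hij : i ≠ j) : s i ≠ s j := by
  intro h
  have h1 : s i * s j = 1 := by rw [h, mul_self_of_mem_reflectionsD hn (hs.mem j)]
  by_cases hadj : Γ.Adj i j
  · have := hs.orderOf_eq_three i j hij hadj
    rw [h1, orderOf_one] at this; omega
  · have := hs.orderOf_eq_two i j hij hadj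
    rw [h1, orderOf_one] at this; omega

/-- Two vertices of the Carter diagram are joined if and only if their roots are not orthogonal. -/
lemma IsCarterDecomposition.dot_eq_zero_iff (hn : 2 ≤ n)
    (hs : IsCarterDecomposition (reflectionsD n) w Γ s) {i j : Fin n} (hij : i ≠ j) :
    rootOf (s i) ⬝ᵥ rootOf (s j) = 0 ↔ ¬ Γ.Adj i j := by
  have hi := inv_of_mem_reflectionsD hn (hs.mem i)
  have hj := inv_of_mem_reflectionsD hn (hs.mem j)
  have hcomm : Commute (s i) (s j) ↔ (s i * s j) ^ 2 = 1 := by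
    constructor
    · intro h
      rw [h.mul_pow, pow_two, pow_two, mul_self_of_mem_reflectionsD hn (hs.mem i),
        mul_self_of_mem_reflectionsD hn (hs.mem j), one_mul]
    · intro h
      rw [pow_two] at h
      have h2 := eq_inv_of_mul_eq_one_left h
      rwa [mul_inv_rev, hi, hj] at h2
  rw [dot_rootOf_eq_zero_iff_commute hn (hs.mem i) (hs.mem j) (hs.injective hn hij), hcomm]
  constructor
  · intro h hadj
    have h1 := orderOf_dvd_of_pow_eq_one h
    rw [hs.orderOf_eq_three i j hij hadj] at h1
    omega
  · intro h
    rw [← hs.orderOf_eq_two i j hij h, pow_orderOf_eq_one]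

/-- A coordinate vector which `w = w₁ w₂` negates satisfies `2 e_x = ∑ ⟨e_x, α_i⟩ α_i`: from
`w₂ e_x = - w₁ e_x` one reads off both projections. -/
lemma IsCarterDecomposition.sum_eq_of_act_eq_neg (hn : 2 ≤ n)
    (hs : IsCarterDecomposition (reflectionsD n) w Γ s) {v : Fin n → ℚ} (hv : act w v = -v) :
    ∑ i, (v ⬝ᵥ rootOf (s i)) • rootOf (s i) = (2 : ℚ) • v := by
  obtain ⟨l₁, l₂, hp, h₁, h₂, -, hprod, -⟩ := hs.bipartite
  have hnd : (l₁ ++ l₂).Nodup := hp.nodup_iff.2 (List.nodup_finRange n)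
  have horth : ∀ l : List (Fin n), l.Nodup → (l.Pairwise fun i j => Commute (s i) (s j)) →
      l.Pairwise fun i j => rootOf (s i) ⬝ᵥ rootOf (s j) = 0 := by
    intro l hl hc
    refine (hl.and hc).imp fun {i j} h => ?_
    exact (dot_rootOf_eq_zero_iff_commute hn (hs.mem i) (hs.mem j)
      (hs.injective hn h.1)).2 h.2
  have o₁ := horth l₁ hnd.of_append_left h₁
  have o₂ := horth l₂ hnd.of_append_right h₂
  have hinv : (l₁.map s).prod⁻¹ = (l₁.reverse.map s).prod := by
    rw [List.prod_inv_reverse, List.map_map, List.map_reverse]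
    congr 2
    exact List.map_congr_left fun i _ => inv_of_mem_reflectionsD hn (hs.mem i)
  have e1 : act (l₂.map s).prod v = act (l₁.reverse.map s).prod (-v) := by
    rw [← hinv, ← hv, ← act_mul, ← hprod, List.map_append, List.prod_append, inv_mul_cancel_left]
  have o₁' : l₁.reverse.Pairwise fun i j => rootOf (s i) ⬝ᵥ rootOf (s j) = 0 := by
    rw [List.pairwise_reverse]
    exact o₁.imp fun {i j} h => by rw [dotProduct_comm]; exact h
  rw [act_prod_of_pairwise hn hs.mem l₂ o₂, act_prod_of_pairwise hn hs.mem l₁.reverse o₁',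
    (l₁.reverse_perm.map _).sum_eq] at e1
  have e2 : (l₁.map fun i => (-v ⬝ᵥ rootOf (s i)) • rootOf (s i)).sum =
      -(l₁.map fun i => (v ⬝ᵥ rootOf (s i)) • rootOf (s i)).sum := by
    simp only [neg_dotProduct, neg_smul]
    clear * -
    induction l₁ with
    | nil => simp
    | cons i l ih => rw [List.map_cons, List.sum_cons, ih, List.map_cons, List.sum_cons, neg_add]
  rw [e2] at e1
  have e3 : ∑ i, (v ⬝ᵥ rootOf (s i)) • rootOf (s i) =
      ((l₁ ++ l₂).map fun i => (v ⬝ᵥ rootOf (s i)) • rootOf (s i)).sum := by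
    rw [(hp.map _).sum_eq, Fin.sum_univ_def]
  rw [e3, List.map_append, List.sum_append, two_smul]
  rw [sub_eq_iff_eq_add] at e1
  nth_rewrite 3 [e1]
  abel

end

/-- An element with Carter diagram `Δ_{m,n}`, `2 ≤ m ≤ n / 2`, has no cycle of length one. -/
lemma IsCarterDecomposition.prm_apply_ne (hn : 4 ≤ n) (hm : 1 < m) (hmn : 2 * m ≤ n)
    (hs : IsCarterDecomposition (reflectionsD n) w (carterDiagramD m n) s) (x : Fin n) :
    prm w x ≠ x := by
  intro hx
  have hn2 : 2 ≤ n := by omega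
  have hwx : act w (Pi.single x 1) = -Pi.single x 1 := by
    rw [act_single, hx]
    rcases Int.units_eq_one_or (sgn w x) with h | h
    · have h0 := eq_zero_of_act_eq hn2 hs.reflectionLength_eq (v := Pi.single x 1) (by
        rw [act_single, hx, h]; simp)
      simp at h0
    · rw [h]; simp [Pi.single_neg]
  have hsum := hs.sum_eq_of_act_eq_neg hn2 hwx
  simp only [single_dotProduct, one_mul] at hsum
  choose a b ε hab ha hr using fun i => exists_rootOf_eq hn2 (hs.mem i)
  have hval : ∀ i, rootOf (s i) x = 0 ∨ rootOf (s i) x * rootOf (s i) x = 1 := by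
    intro i
    by_cases h : rootOf (s i) x = 0
    · exact Or.inl h
    · right
      rw [hr] at h ⊢
      obtain ⟨z, ε', σ, hz, hσ, e⟩ := exists_eq_smul_root (hab i) h
      rw [e]; simp [root, hz, hσ]
  -- exactly two roots involve the coordinate `x`
  have hcard : (Finset.univ.filter fun i => rootOf (s i) x ≠ 0).card = 2 := by
    have h1 := congrFun hsum x
    simp only [Finset.sum_apply, Pi.smul_apply, smul_eq_mul, Pi.single_eq_same, mul_one] at h1
    have h2 : ∀ i, rootOf (s i) x * rootOf (s i) x = if rootOf (s i) x ≠ 0 then 1 else 0 := by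
      intro i
      rcases hval i with h | h
      · simp [h]
      · have : rootOf (s i) x ≠ 0 := by intro h0; simp [h0] at h
        simp [this, h]
    simp only [h2] at h1
    rw [Finset.sum_boole] at h1
    exact_mod_cast h1
  obtain ⟨i, j, hij, hset⟩ := Finset.card_eq_two.1 hcard
  have hmem : ∀ k, rootOf (s k) x ≠ 0 ↔ k = i ∨ k = j := by
    intro k
    have : k ∈ (Finset.univ.filter fun i => rootOf (s i) x ≠ 0) ↔ k ∈ ({i, j} : Finset (Fin n)) :=
      by rw [hset]
    simpa using this
  have hi := (hmem i).2 (Or.inl rfl)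
  have hj := (hmem j).2 (Or.inr rfl)
  have hsum2 : rootOf (s i) x • rootOf (s i) + rootOf (s j) x • rootOf (s j) =
      (2 : ℚ) • Pi.single x 1 := by
    rw [← hsum, Fintype.sum_eq_add i j hij]
    intro k hk
    have : rootOf (s k) x = 0 := by
      by_contra h
      rcases (hmem k).1 h with h | h
      exacts [hk.1 h, hk.2 h]
    rw [this, zero_smul]
  have hdotij : rootOf (s i) ⬝ᵥ rootOf (s j) = 0 := by
    have h1 := congrArg (fun v => v ⬝ᵥ rootOf (s i)) hsum2
    simp only [add_dotProduct, smul_dotProduct, rootOf_dot_self hn2 (hs.mem i),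
      single_dotProduct, smul_eq_mul, one_mul] at h1
    have h2 : rootOf (s j) x * (rootOf (s j) ⬝ᵥ rootOf (s i)) = 0 := by linarith
    rw [dotProduct_comm]
    exact (mul_eq_zero.1 h2).resolve_left hj
  have htwin : ∀ k, k ≠ i → k ≠ j →
      rootOf (s i) x * (rootOf (s i) ⬝ᵥ rootOf (s k)) +
        rootOf (s j) x * (rootOf (s j) ⬝ᵥ rootOf (s k)) = 0 := by
    intro k hki hkj
    have h1 := congrArg (fun v => v ⬝ᵥ rootOf (s k)) hsum2
    simp only [add_dotProduct, smul_dotProduct, single_dotProduct, smul_eq_mul, one_mul] at h1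
    have h2 : rootOf (s k) x = 0 := by
      by_contra h
      rcases (hmem k).1 h with h | h
      exacts [hki h, hkj h]
    rw [h1, h2, mul_zero]
  have hnadj : ¬ (carterDiagramD m n).Adj i j := (hs.dot_eq_zero_iff hn2 hij).1 hdotij
  obtain ⟨p, q, hpq, hpi, hqi, hpq'⟩ := exists_common_neighbours hn hm hmn hij (fun k => by
    by_cases hki : k = i
    · subst hki; exact iff_of_false (SimpleGraph.irrefl _) hnadj
    by_cases hkj : k = j
    · subst hkj; exact iff_of_false (fun h => hnadj h.symm) (SimpleGraph.irrefl _)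
    have h := htwin k hki hkj
    rw [← not_iff_not, ← hs.dot_eq_zero_iff hn2 hki, ← hs.dot_eq_zero_iff hn2 hkj,
      dotProduct_comm, dotProduct_comm (rootOf (s k))]
    constructor
    · intro h0
      rw [h0, mul_zero, zero_add] at h
      exact (mul_eq_zero.1 h).resolve_left hj
    · intro h0
      rw [h0, mul_zero, add_zero] at h
      exact (mul_eq_zero.1 h).resolve_left hi)
  -- `y` is the other coordinate of the roots of `s i` and `s j`
  obtain ⟨y, ε', σ, hxy, hσ, hri⟩ := exists_eq_smul_root (hab i) (by rw [← hr]; exact hi)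
  rw [← hr] at hri
  have hσ0 : σ ≠ 0 := by rintro rfl; simp at hσ
  have hiy : rootOf (s i) y ≠ 0 := by
    rw [hri]; simp [root, hxy.symm, hσ0]
  have hjy : rootOf (s j) y ≠ 0 := by
    intro h0
    have h1 := congrFun hsum2 y
    simp only [Pi.add_apply, Pi.smul_apply, smul_eq_mul, h0, Pi.single_eq_of_ne hxy.symm,
      mul_zero, add_zero] at h1
    rcases mul_eq_zero.1 h1 with h | h
    exacts [hi h, hiy h]
  have hky : ∀ k, (carterDiagramD m n).Adj k i → rootOf (s k) y ≠ 0 := by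
    intro k hk h0
    have hki : k ≠ i := hk.ne
    have hkj : k ≠ j := by rintro rfl; exact hnadj hk.symm
    have h2 : rootOf (s k) x = 0 := by
      by_contra h
      rcases (hmem k).1 h with h | h
      exacts [hki h, hkj h]
    refine (hs.dot_eq_zero_iff hn2 hki).1 ?_ hk
    rw [hri, dotProduct_smul, dot_root, h2, h0]
    simp
  have hpy := hky p hpi
  have hqy := hky q hqi
  have hdotpq := (hs.dot_eq_zero_iff hn2 hpq).2 hpq'
  have E1 : rootOf (s i) y • rootOf (s i) + rootOf (s j) y • rootOf (s j) = Pi.single y 2 := by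
    rw [hr i, hr j] at *
    exact smul_add_smul_eq_of_dot_eq_zero (hab i) (hab j) hdotij hiy hjy
  have E2 : rootOf (s p) y • rootOf (s p) + rootOf (s q) y • rootOf (s q) = Pi.single y 2 := by
    rw [hr p, hr q] at *
    exact smul_add_smul_eq_of_dot_eq_zero (hab p) (hab q) hdotpq hpy hqy
  -- a linear dependence among four of the roots
  have hli := linearIndependent_iff'.1 (hs.linearIndependent hn2) Finset.univ
    (fun k => (if k = i then rootOf (s i) y else 0) + (if k = j then rootOf (s j) y else 0)
      - (if k = p then rootOf (s p) y else 0) - (if k = q then rootOf (s q) y else 0)) (by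
      simp only [sub_smul, add_smul, Finset.sum_sub_distrib, Finset.sum_add_distrib, ite_smul,
        zero_smul, Finset.sum_ite_eq', Finset.mem_univ, if_true]
      rw [E1, sub_sub, E2, sub_self])
  have h0 := hli i (Finset.mem_univ _)
  simp only [if_true, hij, if_false, hpi.ne.symm, hqi.ne.symm, add_zero, sub_zero] at h0
  exact hiy h0

/-- The reflections of the diagram act transitively on the signed basis vectors: the indicator vector of
an invariant set of signed basis vectors is fixed by `w`, hence zero, so the set is symmetric; the
connectedness of the diagram does the rest. -/
lemma IsCarterDecomposition.forall_of_closed (hn : 4 ≤ n) (hm : 1 < m) (hmn : 2 * m ≤ n)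
    (hs : IsCarterDecomposition (reflectionsD n) w (carterDiagramD m n) s)
    (A : Fin n → ℤˣ → Prop)
    (hA : ∀ k i j ε δ, i ≠ j → s k = R i j ε → A i δ → A j (ε * δ)) {i₀ : Fin n} {δ₀ : ℤˣ}
    (h₀ : A i₀ δ₀) (i : Fin n) (δ : ℤˣ) : A i δ := by
  classical
  have hn2 : 2 ≤ n := by omega
  choose a b ε hab ha hr using fun i => exists_rootOf_eq hn2 (hs.mem i)
  have hA' : ∀ k δ, A (a k) δ ↔ A (b k) (ε k * δ) := by
    intro k δ
    refine ⟨hA k _ _ _ _ (hab k) (ha k), fun h => ?_⟩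
    have h2 := hA k _ _ _ _ (hab k).symm ((ha k).trans (R_comm _ _ _)) h
    rwa [← mul_assoc, Int.units_mul_self, one_mul] at h2
  have hv : (fun i => (if A i 1 then 1 else 0) - (if A i (-1) then 1 else 0) : Fin n → ℚ) = 0 := by
    refine hs.eq_zero hn2 fun k => ?_
    rw [ha k]
    refine act_R_of_dot_eq_zero (hab k) _ ?_
    rw [dot_root]
    have h1 := hA' k 1
    have h2 := hA' k (-1)
    rcases Int.units_eq_one_or (ε k) with h | h <;> rw [h] at h1 h2 ⊢ <;>
      simp [h1, h2]
  have hsymm : ∀ i, A i 1 ↔ A i (-1) := by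
    intro i
    have h := congrFun hv i
    by_cases h1 : A i 1 <;> by_cases h2 : A i (-1) <;> simp [h1, h2] at h ⊢
  have hsign : ∀ i δ, A i δ ↔ A i 1 := by
    intro i δ
    rcases Int.units_eq_one_or δ with rfl | rfl
    · rfl
    · exact (hsymm i).symm
  have hab' : ∀ k, A (a k) 1 ↔ A (b k) 1 := fun k => by rw [hA', hsign]
  have hsupp : ∀ k i, rootOf (s k) i ≠ 0 ↔ i = a k ∨ i = b k := by
    intro k i
    rw [hr]
    by_cases h1 : i = a k
    · subst h1; simp [root, hab k]
    · by_cases h2 : i = b k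
      · rw [h2]; simp [root, (hab k).symm]
      · simp [root, h1, h2]
  have hmoved : ∀ i, ∃ k, rootOf (s k) i ≠ 0 := by
    intro i
    by_contra hcon
    push Not at hcon
    have h := hs.eq_zero hn2 (v := Pi.single i 1) fun k => by
      rw [act_rootOf hn2 (hs.mem k), single_dotProduct, hcon k]; simp
    simp at h
  obtain ⟨k₀, hk₀⟩ := hmoved i₀
  have hstart : A (a k₀) 1 := by
    rw [hsign] at h₀
    rcases (hsupp _ _).1 hk₀ with h | h
    · rwa [← h]
    · rwa [hab', ← h]
  have hall := carterDiagramD_connected hm hmn (fun k => A (a k) 1) (by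
    intro k k' hadj hk
    have hdot : rootOf (s k') ⬝ᵥ rootOf (s k) ≠ 0 := fun h =>
      (hs.dot_eq_zero_iff hn2 hadj.ne.symm).1 h hadj.symm
    rw [hr k, dot_root] at hdot
    have : rootOf (s k') (a k) ≠ 0 ∨ rootOf (s k') (b k) ≠ 0 := by
      by_contra hcon
      push Not at hcon
      rw [hcon.1, hcon.2] at hdot
      simp at hdot
    have hk2 := (hab' k).1 hk
    rcases this with h | h <;> rcases (hsupp _ _).1 h with h | h
    · rwa [← h]
    · rwa [hab', ← h]
    · rwa [← h]
    · rwa [hab', ← h]) hstart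
  rw [hsign]
  obtain ⟨k, hk⟩ := hmoved i
  rcases (hsupp _ _).1 hk with h | h
  · rw [h]; exact hall k
  · rw [h, ← hab']; exact hall k

end Carter

/-! ### Pairs of reflections below a product of two negative cycles -/

section Pairs

variable {n m : ℕ} {w : WD n}

/-- The combinatorial structure of a product `w` of two negative cycles of length at least two: `c` is the
colouring of the coordinates by the two cycles, and `χ i j`, for `i` and `j` on the same cycle, is the sign of
`⟨(1 - w)⁻¹ e_i, e_j⟩ = ± 1/2`. The last fields say which products of two reflections are reduced
decompositions of elements of `[1, w]`. -/
structure IsTwoCycle (w : WD n) (c : Fin n → Bool) (χ : Fin n → Fin n → ℤˣ) : Prop where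
  exists_same : ∀ i, ∃ j, j ≠ i ∧ c j = c i
  exists_other : ∀ i, ∃ j, c j ≠ c i
  antisymm : ∀ i j, i ≠ j → c i = c j → χ j i = - χ i j
  compat_double : ∀ i j ε, c i ≠ c j → Compat w (R i j ε) (R i j (-ε))
  compat_cross_cross : ∀ a b d ε δ, c a ≠ c b → c b = c d → b ≠ d → ε * δ * χ b d = -1 →
    Compat w (R a b ε) (R a d δ)
  compat_cross_chord : ∀ a b d ε δ, c a ≠ c b → c b = c d → b ≠ d → δ * χ b d = 1 →
    Compat w (R a b ε) (R b d δ)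
  compat_chord_cross : ∀ a b d ε δ, c a ≠ c b → c b = c d → b ≠ d → δ * χ d b = 1 →
    Compat w (R b d δ) (R a b ε)
  compat_chord_chord : ∀ a b d e ε δ, a ≠ b → d ≠ e → c a = c b → c d = c e → c a ≠ c d →
    Compat w (R a b ε) (R d e δ)

lemma IsCarterDecomposition.exists_isTwoCycle {s : Fin n → WD n} (hn : 4 ≤ n) (hm : 1 < m)
    (hmn : 2 * m ≤ n) (hq : IsQuasiCoxeter (reflectionsD n) w)
    (hs : IsCarterDecomposition (reflectionsD n) w (carterDiagramD m n) s) :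
    ∃ c χ, IsTwoCycle w c χ := by
  classical
  have hn2 : 2 ≤ n := by omega
  have hw := hs.reflectionLength_eq
  obtain ⟨H, hH⟩ := exists_isCayley hn2 hw
  let i₀ : Fin n := ⟨0, by omega⟩
  let c : Fin n → Bool := fun i => decide ((prm w).SameCycle i₀ i)
  let χ : Fin n → Fin n → ℤˣ := fun i j => if H i j = 1 / 2 then 1 else -1
  have hc : ∀ i j, c i = c j ↔ (prm w).SameCycle i j := by
    intro i j
    simp only [c, decide_eq_decide]
    constructor
    · intro h
      by_cases h1 : (prm w).SameCycle i₀ i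
      · exact h1.symm.trans (h.1 h1)
      · exact sameCycle_of_not_sameCycle hn2 hw hq h1 (fun h2 => h1 (h.2 h2))
    · exact fun h => ⟨fun h1 => h1.trans h, fun h1 => h1.trans h.symm⟩
  have hsame : ∀ i j, c i = c j → H i j = ((χ i j : ℤ) : ℚ) / 2 := by
    intro i j hij
    rcases hH.of_sameCycle ((hc i j).1 hij) with h | h
    · simp [χ, h]
    · simp only [χ, h]; norm_num
  have hdiff : ∀ i j, c i ≠ c j → H i j = 0 := fun i j hij =>
    hH.of_not_sameCycle hn2 hw fun h => hij ((hc i j).2 h)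
  have hunit : ∀ a b : ℤˣ, a * b = 1 → ((a : ℤ) : ℚ) * ((b : ℤ) : ℚ) = 1 := by
    intro a b h
    have := congrArg (fun z : ℤˣ => ((z : ℤ) : ℚ)) h
    simpa using this
  have hne : ∀ {x y}, c x ≠ c y → x ≠ y := fun {x y} h e => h (by rw [e])
  refine ⟨c, χ, ?_, ?_, ?_, ?_, ?_, ?_, ?_, ?_⟩
  · intro i
    refine ⟨prm w i, hs.prm_apply_ne hn hm hmn i, ?_⟩
    rw [hc, Equiv.Perm.sameCycle_apply_left]
  · intro i
    obtain ⟨j, hj⟩ := exists_not_sameCycle hn2 hw i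
    exact ⟨j, fun h => hj ((hc j i).1 h).symm⟩
  · intro i j hij h
    have h1 := hH.antisymm hij
    rw [hsame i j h, hsame j i h.symm] at h1
    apply Units.ext
    have h2 : ((χ j i : ℤ) : ℚ) = ((-χ i j : ℤˣ) : ℤ) := by push_cast; linarith
    exact_mod_cast h2
  · intro i j ε hij
    refine hH.compat hn2 hw (hne hij) (hne hij) _ _ ?_
    rw [hH.self, hH.self, hdiff i j hij, hdiff j i hij.symm]
    have := units_rat_mul_self ε
    push_cast
    linear_combination (-1 / 2 : ℚ) * this
  · intro a b d ε δ hab hbd hne' h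
    refine hH.compat hn2 hw (hne hab) (hne (hbd ▸ hab)) _ _ ?_
    rw [hH.self, hdiff b a hab.symm, hdiff a d (hbd ▸ hab), hsame b d hbd]
    have := hunit (ε * δ) (-χ b d) (by rw [mul_neg, h, neg_neg])
    push_cast at this
    linear_combination (-1 / 2 : ℚ) * this
  · intro a b d ε δ hab hbd hne' h
    refine hH.compat hn2 hw (hne hab) hne' _ _ ?_
    rw [hH.self, hdiff a b hab, hdiff a d (hbd ▸ hab), hsame b d hbd]
    have := hunit _ _ h
    linear_combination ((ε : ℤ) : ℚ) / 2 * this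
  · intro a b d ε δ hab hbd hne' h
    refine hH.compat hn2 hw hne' (hne hab) _ _ ?_
    rw [hH.self, hdiff b a hab.symm, hdiff d a (hbd ▸ hab.symm), hsame d b hbd.symm]
    have := hunit _ _ h
    linear_combination ((ε : ℤ) : ℚ) / 2 * this
  · intro a b d e ε δ hab hde h1 h2 h3
    refine hH.compat hn2 hw hab hde _ _ ?_
    rw [hdiff a d h3, hdiff b d (h1 ▸ h3), hdiff a e (h2 ▸ h3), hdiff b e (h1 ▸ h2 ▸ h3)]
    simp

/-- One of the two products of the reflections `t` and `t'` is a reduced decomposition of an element of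
`[1, w]`. -/
def Link (w t t' : WD n) : Prop := Compat w t t' ∨ Compat w t' t

lemma Link.symm {t t' : WD n} (h : Link w t t') : Link w t' t := Or.symm h

variable {c : Fin n → Bool} {χ : Fin n → Fin n → ℤˣ}

lemma ne_of_color_ne {a b : Fin n} (h : c a ≠ c b) : a ≠ b := fun e => h (by rw [e])

lemma IsTwoCycle.link_double (hc : IsTwoCycle w c χ) {i j : Fin n} (hij : c i ≠ c j) {ε δ : ℤˣ}
    (h : ε ≠ δ) : Link w (R i j ε) (R i j δ) := by
  have h1 := hc.compat_double i j ε hij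
  rw [← Int.units_ne_iff_eq_neg.1 (Ne.symm h)] at h1
  exact Or.inl h1

lemma IsTwoCycle.link_cross_cross (hc : IsTwoCycle w c χ) {a b d : Fin n} (hab : c a ≠ c b)
    (hbd : c b = c d) (hne : b ≠ d) (ε δ : ℤˣ) : Link w (R a b ε) (R a d δ) := by
  rcases Int.units_eq_one_or (ε * δ * χ b d) with h | h
  · right
    refine hc.compat_cross_cross a d b δ ε (hbd ▸ hab) hbd.symm hne.symm ?_
    rw [hc.antisymm b d hne hbd, mul_neg, mul_comm δ, h]
  · left
    exact hc.compat_cross_cross a b d ε δ hab hbd hne h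

lemma IsTwoCycle.link_cross_chord (hc : IsTwoCycle w c χ) {a b d : Fin n} (hab : c a ≠ c b)
    (hbd : c b = c d) (hne : b ≠ d) (ε δ : ℤˣ) : Link w (R a b ε) (R b d δ) := by
  rcases Int.units_eq_one_or (δ * χ b d) with h | h
  · exact Or.inl (hc.compat_cross_chord a b d ε δ hab hbd hne h)
  · right
    refine hc.compat_chord_cross a b d ε δ hab hbd hne ?_
    rw [hc.antisymm b d hne hbd, mul_neg, h, neg_neg]

lemma IsTwoCycle.link_chord_chord (hc : IsTwoCycle w c χ) {a b d e : Fin n} (hab : a ≠ b)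
    (hde : d ≠ e) (h1 : c a = c b) (h2 : c d = c e) (h3 : c a ≠ c d) (ε δ : ℤˣ) :
    Link w (R a b ε) (R d e δ) :=
  Or.inl (hc.compat_chord_chord a b d e ε δ hab hde h1 h2 h3)

lemma color_eq_of_ne (a b d : Fin n) (h1 : c a ≠ c b) (h2 : c a ≠ c d) : c b = c d := by
  revert h1 h2
  cases c a <;> cases c b <;> cases c d <;> simp

/-! ### The reflections of the diagram generate the interval group -/

/-- A subgroup which contains two linked reflections contains the conjugate of one by the other. -/
lemma Link.conj_mem (hn : 2 ≤ n) (hw : reflectionLength (reflectionsD n) w = n)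
    {S : Subgroup (IntervalGroup (reflectionsD n) w)} {t t' : WD n} (ht : t ∈ reflectionsD n)
    (ht' : t' ∈ reflectionsD n) (h : Link w t t') (h1 : tau w t ∈ S) (h2 : tau w t' ∈ S) :
    tau w (t * t' * t) ∈ S := by
  rcases h with h | h
  · have e := h.tau_mul_left hn hw ht ht'
    rw [eq_mul_inv_of_mul_eq e.symm]
    exact mul_mem (mul_mem h1 h2) (inv_mem h1)
  · rw [eq_inv_mul_of_mul_eq (h.tau_mul_right hn hw ht' ht).symm]
    exact mul_mem (inv_mem h1) (mul_mem h2 h1)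

variable {S : Subgroup (IntervalGroup (reflectionsD n) w)}

lemma R_mem_reflectionsD (hn : 2 ≤ n) {i j : Fin n} (hij : i ≠ j) (ε : ℤˣ) :
    R i j ε ∈ reflectionsD n := (mem_reflectionsD hn).2 ⟨i, j, ε, hij, rfl⟩

/-- Two crosses sharing a coordinate give a chord. -/
lemma IsTwoCycle.chord_mem (hn : 2 ≤ n) (hw : reflectionLength (reflectionsD n) w = n)
    (hc : IsTwoCycle w c χ) {a b d : Fin n} {ε δ : ℤˣ} (hab : c a ≠ c b) (hbd : c b = c d)
    (hne : b ≠ d) (h1 : tau w (R a b ε) ∈ S) (h2 : tau w (R a d δ) ∈ S) :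
    tau w (R b d (ε * δ)) ∈ S := by
  have had : c a ≠ c d := hbd ▸ hab
  have h := Link.conj_mem hn hw (R_mem_reflectionsD hn (ne_of_color_ne hab) ε)
    (R_mem_reflectionsD hn (ne_of_color_ne had) δ) (hc.link_cross_cross hab hbd hne ε δ) h1 h2
  rwa [R_comm a b, R_conj_share (ne_of_color_ne hab.symm) hne (ne_of_color_ne had)] at h

/-- A cross and a chord sharing a coordinate give another cross. -/
lemma IsTwoCycle.cross_mem (hn : 2 ≤ n) (hw : reflectionLength (reflectionsD n) w = n)
    (hc : IsTwoCycle w c χ) {a b d : Fin n} {ε δ : ℤˣ} (hab : c a ≠ c b) (hbd : c b = c d)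
    (hne : b ≠ d) (h1 : tau w (R a b ε) ∈ S) (h2 : tau w (R b d δ) ∈ S) :
    tau w (R a d (ε * δ)) ∈ S := by
  have had : c a ≠ c d := hbd ▸ hab
  have h := Link.conj_mem hn hw (R_mem_reflectionsD hn (ne_of_color_ne hab) ε)
    (R_mem_reflectionsD hn hne δ) (hc.link_cross_chord hab hbd hne ε δ) h1 h2
  rwa [R_conj_share (ne_of_color_ne hab) (ne_of_color_ne had) hne] at h

/-- Three crosses which form a path give the cross that closes the path. -/
lemma IsTwoCycle.path_mem (hn : 2 ≤ n) (hw : reflectionLength (reflectionsD n) w = n)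
    (hc : IsTwoCycle w c χ) {x b a y : Fin n} {ε₁ ε₂ ε₃ : ℤˣ} (hab : c a ≠ c b)
    (hxa : c x = c a) (hby : c b = c y) (h1 : tau w (R x b ε₁) ∈ S) (h2 : tau w (R a b ε₂) ∈ S)
    (h3 : tau w (R a y ε₃) ∈ S) : tau w (R x y (ε₁ * ε₂ * ε₃)) ∈ S := by
  have hxb : c x ≠ c b := hxa ▸ hab
  by_cases hyb : b = y
  · subst hyb
    by_cases hax : x = a
    · subst hax
      have key : ε₁ * ε₂ * ε₃ = ε₁ ∨ ε₁ * ε₂ * ε₃ = ε₂ ∨ ε₁ * ε₂ * ε₃ = ε₃ := by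
        have hdec : ∀ x y z : ℤˣ, x * y * z = x ∨ x * y * z = y ∨ x * y * z = z := by decide
        exact hdec _ _ _
      rcases key with h | h | h <;> rw [h] <;> assumption
    · rw [R_comm] at h1 h2 h3 ⊢
      have hch := hc.chord_mem hn hw hxb.symm hxa hax h1 h2
      rw [R_comm] at hch
      have h := hc.cross_mem hn hw hab.symm hxa.symm (Ne.symm hax) h3 hch
      rwa [mul_comm] at h
  · have hch := hc.chord_mem hn hw hab hby hyb h2 h3
    have h := hc.cross_mem hn hw hxb hby hyb h1 hch
    rwa [← mul_assoc] at h

lemma IsCarterDecomposition.closure_tau_eq_top {s : Fin n → WD n} (hn : 4 ≤ n) (hm : 1 < m)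
    (hmn : 2 * m ≤ n) (hc : IsTwoCycle w c χ)
    (hs : IsCarterDecomposition (reflectionsD n) w (carterDiagramD m n) s) :
    Subgroup.closure (Set.range fun i => tau w (s i)) = ⊤ := by
  have hn2 : 2 ≤ n := by omega
  have hw := hs.reflectionLength_eq
  set S := Subgroup.closure (Set.range fun i => tau w (s i)) with hS
  have hmem : ∀ k, tau w (s k) ∈ S := fun k => Subgroup.subset_closure ⟨k, rfl⟩
  -- some reflection of the diagram is a cross
  obtain ⟨a, b, ε₀, hab, h₀⟩ : ∃ a b ε, c a ≠ c b ∧ tau w (R a b ε) ∈ S := by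
    by_contra hcon
    push Not at hcon
    let i₀ : Fin n := ⟨0, by omega⟩
    obtain ⟨j, hj⟩ := hc.exists_other i₀
    refine hj (hs.forall_of_closed hn hm hmn (fun i _ => c i = c i₀) ?_ (i₀ := i₀) (δ₀ := 1)
      rfl j 1)
    intro k i j ε δ hij hk hi
    by_contra hne
    exact hcon i j ε (fun e => hne (by rw [← e]; exact hi)) (hk ▸ hmem k)
  have key : ∀ i δ, (c i = c a → tau w (R i b (δ * ε₀)) ∈ S) ∧
      (c i = c b → tau w (R a i δ) ∈ S) := by
    refine hs.forall_of_closed hn hm hmn (fun i δ => (c i = c a → tau w (R i b (δ * ε₀)) ∈ S) ∧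
      (c i = c b → tau w (R a i δ) ∈ S)) ?_ (i₀ := a) (δ₀ := 1)
      ⟨fun _ => by rwa [one_mul], fun h => absurd h hab⟩
    intro k p q ε δ hpq hk ⟨hpa, hpb⟩
    have hkS : tau w (R p q ε) ∈ S := hk ▸ hmem k
    have hcol : ∀ x, c x = c a ∨ c x = c b := fun x => by
      by_cases h : c x = c a
      · exact Or.inl h
      · exact Or.inr (color_eq_of_ne a x b (Ne.symm h) hab)
    have comm4 : ∀ x y z : ℤˣ, x * y * z = y * z * x := by decide
    rcases hcol p with h1 | h1
    · have hp := hpa h1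
      constructor
      · intro h2
        rw [R_comm] at hp ⊢
        have h := hc.cross_mem hn2 hw (h1 ▸ hab.symm) (h1.trans h2.symm) hpq hp hkS
        rwa [comm4]
      · intro h2
        rw [R_comm] at hkS
        have h := hc.path_mem hn2 hw (S := S) (x := a) (b := b) (a := p) (y := q) (h1 ▸ hab)
          h1.symm h2.symm h₀ hp (by rwa [R_comm])
        have e : ε * δ = ε₀ * (δ * ε₀) * ε := by
          have hdec : ∀ x y z : ℤˣ, x * y = z * (y * z) * x := by decide
          exact hdec _ _ _
        rwa [e]
    · have hp := hpb h1
      constructor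
      · intro h2
        have h := hc.path_mem hn2 hw (S := S) (x := q) (b := p) (a := a) (y := b) (h1 ▸ hab)
          h2 h1 (by rwa [R_comm]) hp h₀
        exact h
      · intro h2
        have h := hc.cross_mem hn2 hw (h1 ▸ hab) (h1.trans h2.symm) hpq hp hkS
        rwa [mul_comm] at h
  have hcross : ∀ x y ε, c x = c a → c y = c b → tau w (R x y ε) ∈ S := by
    intro x y ε hx hy
    have h := hc.path_mem hn2 hw hab hx hy.symm ((key x 1).1 hx) h₀ ((key y ε).2 hy)
    have e : 1 * ε₀ * ε₀ * ε = ε := by rw [one_mul, Int.units_mul_self, one_mul]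
    rwa [e] at h
  rw [eq_top_iff, ← closure_tau hn2 hw, Subgroup.closure_le]
  rintro _ ⟨t, ht, rfl⟩
  obtain ⟨i, j, ε, hij, rfl⟩ := (mem_reflectionsD hn2).1 ht
  have hcol : ∀ x, c x ≠ c a → c x = c b := fun x h =>
    color_eq_of_ne a x b (Ne.symm h) hab
  change tau w (R i j ε) ∈ S
  by_cases h1 : c i = c a <;> by_cases h2 : c j = c a
  · have h := hc.chord_mem hn2 hw (a := b) (b := i) (d := j) (ε := 1) (δ := ε)
      (h1 ▸ hab.symm) (h1.trans h2.symm) hij (by rw [R_comm]; exact hcross _ _ _ h1 rfl)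
      (by rw [R_comm]; exact hcross _ _ _ h2 rfl)
    rwa [one_mul] at h
  · exact hcross _ _ _ h1 (hcol j h2)
  · rw [R_comm]; exact hcross _ _ _ h2 (hcol i h1)
  · have h := hc.chord_mem hn2 hw (a := a) (b := i) (d := j) (ε := 1) (δ := ε)
      (Ne.symm h1) ((hcol i h1).trans (hcol j h2).symm) hij (hcross _ _ _ rfl (hcol i h1))
      (hcross _ _ _ rfl (hcol j h2))
    rwa [one_mul] at h

end Pairs

/-! ### Equivariance -/

section Equivariance

variable {n : ℕ} {w : WD n} {c : Fin n → Bool} {χ : Fin n → Fin n → ℤˣ}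

/-- A family `a t` of points, indexed by the reflections `t`, on which operators `θ t` act in a way which is
compatible with the dual braid relations below `w`. The conclusion to be drawn is that `θ s` maps `a t` to
`a (s t s)` for all reflections `s` and `t`, also when neither `s t` nor `t s` is below `w`. -/
structure IsDualBraidFamily {Y : Type*} (w : WD n) (θ : WD n → Equiv.Perm Y) (a : WD n → Y) :
    Prop where
  self : ∀ t ∈ reflectionsD n, θ t (a t) = a t
  sq : ∀ s ∈ reflectionsD n, ∀ t ∈ reflectionsD n, θ s (θ s (a t)) = a t
  compat : ∀ s ∈ reflectionsD n, ∀ t ∈ reflectionsD n, Compat w s t → θ s (a t) = a (s * t * s)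
  mul : ∀ s ∈ reflectionsD n, ∀ t ∈ reflectionsD n, θ s (a t) = a (s * t * s) →
    θ s * θ t = θ (s * t * s) * θ s

variable {Y : Type*} {θ : WD n → Equiv.Perm Y} {a : WD n → Y}

lemma conj_conj_cancel (hn : 2 ≤ n) {s : WD n} (hs : s ∈ reflectionsD n) (t : WD n) :
    s * (s * t * s) * s = t := by
  have h := mul_self_of_mem_reflectionsD hn hs
  calc s * (s * t * s) * s = (s * s) * t * (s * s) := by group
    _ = t := by rw [h, one_mul, mul_one]

lemma IsDualBraidFamily.of_link (hn : 2 ≤ n) (hf : IsDualBraidFamily w θ a)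
    {s t : WD n} (hs : s ∈ reflectionsD n) (ht : t ∈ reflectionsD n) (h : Link w s t) :
    θ s (a t) = a (s * t * s) := by
  rcases h with h | h
  · exact hf.compat s hs t ht h
  · -- `t s = s (s t s)`, so `s` and `s t s` are compatible
    have hst := conj_mem_reflectionsD' hn hs ht
    have e : s * (s * t * s) = t * s := by
      rw [← mul_assoc, ← mul_assoc, mul_self_of_mem_reflectionsD hn hs, one_mul]
    have h1 := hf.compat s hs _ hst (by unfold Compat; rw [e]; exact h)
    rw [conj_conj_cancel hn hs] at h1
    have h2 := hf.sq s hs _ hst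
    rwa [h1] at h2

/-- The case of two crosses. For disjoint crosses `(a b)` and `(p q)`, conjugation with `(a q)` turns them into
chords of different colours, whose product is below `w`. -/
lemma IsDualBraidFamily.cross_cross (hn : 2 ≤ n) (hc : IsTwoCycle w c χ)
    (hf : IsDualBraidFamily w θ a) {i j p q : Fin n} (hij : c i ≠ c j) (hpi : c p = c i)
    (hqj : c q = c j) (ε δ : ℤˣ) :
    θ (R i j ε) (a (R p q δ)) = a (R i j ε * R p q δ * R i j ε) := by
  have hpq : c p ≠ c q := by rw [hpi, hqj]; exact hij
  have hiq : c i ≠ c q := by rw [hqj]; exact hij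
  have hpj : c p ≠ c j := by rw [hpi]; exact hij
  have hs := R_mem_reflectionsD hn (ne_of_color_ne hij) ε
  have ht := R_mem_reflectionsD hn (ne_of_color_ne hpq) δ
  by_cases h1 : p = i
  · subst h1
    by_cases h2 : q = j
    · subst h2
      by_cases h3 : ε = δ
      · subst h3
        rw [R_mul_self, one_mul]; exact hf.self _ hs
      · exact hf.of_link hn hs ht (hc.link_double hij h3)
    · exact hf.of_link hn hs ht (hc.link_cross_cross hij hqj.symm (Ne.symm h2) ε δ)
  by_cases h2 : q = j
  · subst h2
    refine hf.of_link hn hs ht ?_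
    rw [R_comm i, R_comm p]
    exact hc.link_cross_cross hij.symm hpi.symm (Ne.symm h1) ε δ
  have hr := R_mem_reflectionsD hn (ne_of_color_ne hiq) 1
  have hrs := hf.of_link hn hr hs (hc.link_cross_cross hiq hqj h2 1 ε)
  have hrt := hf.of_link hn hr ht (by
    rw [R_comm i, R_comm p]
    exact hc.link_cross_cross hiq.symm hpi.symm (Ne.symm h1) 1 δ)
  have es : R i q 1 * R i j ε * R i q 1 = R q j (1 * ε) := by
    rw [R_comm i q]; exact R_conj_share (ne_of_color_ne hiq.symm) h2 (ne_of_color_ne hij) 1 ε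
  have et : R i q 1 * R p q δ * R i q 1 = R i p (1 * δ) := by
    rw [R_comm p q]
    exact R_conj_share (ne_of_color_ne hiq) (Ne.symm h1) (ne_of_color_ne hpq.symm) 1 δ
  have e1 : R i j ε * R p q δ * R i j ε = R p q δ :=
    R_conj_disjoint (Ne.symm h1) (ne_of_color_ne hiq) (ne_of_color_ne hpj.symm) (Ne.symm h2) ε δ
  have e2 : R q j (1 * ε) * R i p (1 * δ) * R q j (1 * ε) = R i p (1 * δ) :=
    R_conj_disjoint (ne_of_color_ne hiq.symm) (ne_of_color_ne hpq.symm) (ne_of_color_ne hij.symm)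
      (ne_of_color_ne hpj.symm) _ _
  have hmul := congrArg (fun f => f (a (R p q δ))) (hf.mul _ hr _ hs hrs)
  have hst := hf.of_link hn (R_mem_reflectionsD hn h2 (1 * ε))
    (R_mem_reflectionsD hn (Ne.symm h1) (1 * δ))
    (hc.link_chord_chord h2 (Ne.symm h1) hqj hpi.symm hiq.symm _ _)
  simp only [Equiv.Perm.mul_apply] at hmul
  rw [hrt, es, et, hst, e2, ← et, ← hrt] at hmul
  rw [e1]
  exact (θ _).injective hmul

/-- The case of a cross and a chord of the colour of its first end. A chord `(p q)` is the conjugate of the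
cross `(b' q)` by the cross `(p b')`; if it is disjoint from the cross `(i j)`, then `b'` can be chosen
different from `j`. -/
lemma IsDualBraidFamily.cross_chord (hn : 2 ≤ n) (hc : IsTwoCycle w c χ)
    (hf : IsDualBraidFamily w θ a) {i j p q : Fin n} (hij : c i ≠ c j) (hpi : c p = c i)
    (hqi : c q = c i) (hpq : p ≠ q) (ε δ : ℤˣ) :
    θ (R i j ε) (a (R p q δ)) = a (R i j ε * R p q δ * R i j ε) := by
  have hs := R_mem_reflectionsD hn (ne_of_color_ne hij) ε
  have ht := R_mem_reflectionsD hn hpq δ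
  by_cases h1 : p = i
  · subst h1
    refine hf.of_link hn hs ht ?_
    rw [R_comm p j]
    exact hc.link_cross_chord hij.symm hqi.symm hpq ε δ
  by_cases h2 : q = i
  · subst h2
    refine hf.of_link hn hs ht ?_
    rw [R_comm q j, R_comm p q]
    exact hc.link_cross_chord hij.symm hpi.symm hpq.symm ε δ
  obtain ⟨k, hkj, hk⟩ := hc.exists_same j
  have hpk : c p ≠ c k := by rw [hpi, hk]; exact hij
  have hqk : c q ≠ c k := by rw [hqi, hk]; exact hij
  have hik : c i ≠ c k := by rw [hk]; exact hij
  have hpj : c p ≠ c j := by rw [hpi]; exact hij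
  have hqj : c q ≠ c j := by rw [hqi]; exact hij
  have hr := R_mem_reflectionsD hn (ne_of_color_ne hpk) 1
  have hsr := hf.cross_cross hn hc hij hpi hk ε 1
  have hst' := hf.cross_cross hn hc hij hqi hk ε δ
  have hrt' := hf.cross_cross hn hc hpk (hqi.trans hpi.symm) rfl 1 δ
  have e1 : R i j ε * R p k 1 * R i j ε = R p k 1 :=
    R_conj_disjoint (Ne.symm h1) (ne_of_color_ne hik) (ne_of_color_ne hpj.symm) (Ne.symm hkj) ε 1
  have e2 : R i j ε * R q k δ * R i j ε = R q k δ :=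
    R_conj_disjoint (Ne.symm h2) (ne_of_color_ne hik) (ne_of_color_ne hqj.symm) (Ne.symm hkj) ε δ
  have e3 : R p k 1 * R q k δ * R p k 1 = R p q δ := by
    rw [R_comm q k, R_conj_share (ne_of_color_ne hpk) hpq (ne_of_color_ne hqk.symm), one_mul]
  have e4 : R i j ε * R p q δ * R i j ε = R p q δ :=
    R_conj_disjoint (Ne.symm h1) (Ne.symm h2) (ne_of_color_ne hpj.symm) (ne_of_color_ne hqj.symm) ε δ
  have hmul := congrArg (fun f => f (a (R q k δ))) (hf.mul _ hs _ hr hsr)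
  simp only [Equiv.Perm.mul_apply] at hmul
  rw [e1, hst', e2, hrt', e3] at hmul
  rw [e4, hmul]

/-- In a dual braid family, `θ s` maps `a t` to `a (s t s)` for all reflections `s` and `t`. -/
theorem IsDualBraidFamily.apply_eq (hn : 2 ≤ n) (hc : IsTwoCycle w c χ)
    (hf : IsDualBraidFamily w θ a) {s t : WD n} (hs : s ∈ reflectionsD n)
    (ht : t ∈ reflectionsD n) : θ s (a t) = a (s * t * s) := by
  have hcross : ∀ i j ε, c i ≠ c j → ∀ t ∈ reflectionsD n,
      θ (R i j ε) (a t) = a (R i j ε * t * R i j ε) := by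
    intro i j ε hij t ht
    obtain ⟨p, q, δ, hpq, rfl⟩ := (mem_reflectionsD hn).1 ht
    have hcol : ∀ x, c x ≠ c i → c x = c j := fun x h =>
      color_eq_of_ne i x j (Ne.symm h) hij
    by_cases h1 : c p = c i <;> by_cases h2 : c q = c i
    · exact hf.cross_chord hn hc hij h1 h2 hpq ε δ
    · exact hf.cross_cross hn hc hij h1 (hcol q h2) ε δ
    · rw [R_comm p q]
      exact hf.cross_cross hn hc hij h2 (hcol p h1) ε δ
    · rw [R_comm i j]
      exact hf.cross_chord hn hc hij.symm (hcol p h1) (hcol q h2) hpq ε δ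
  obtain ⟨p, q, ε, hpq, rfl⟩ := (mem_reflectionsD hn).1 hs
  by_cases h : c p = c q
  · obtain ⟨d, hd⟩ := hc.exists_other p
    have hdq : c d ≠ c q := h ▸ hd
    have hr := R_mem_reflectionsD hn (ne_of_color_ne hd.symm) 1
    have hs' := R_mem_reflectionsD hn (ne_of_color_ne hdq) ε
    have e : R p d 1 * R d q ε * R p d 1 = R p q ε := by
      rw [R_conj_share (ne_of_color_ne hd.symm) hpq (ne_of_color_ne hdq), one_mul]
    have ht0 := conj_mem_reflectionsD' hn hr ht
    have h1 := hcross p d 1 hd.symm _ ht0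
    rw [conj_conj_cancel hn hr] at h1
    have h2 := hcross d q ε hdq _ ht0
    have h3 := hcross p d 1 hd.symm _ (conj_mem_reflectionsD' hn hs' ht0)
    have hmul := congrArg (fun f => f (a (R p d 1 * t * R p d 1)))
      (hf.mul _ hr _ hs' (hcross p d 1 hd.symm _ hs'))
    simp only [Equiv.Perm.mul_apply] at hmul
    rw [e, h1, h2, h3] at hmul
    rw [← hmul, ← e]
    congr 1
    group
  · exact hcross p q ε h t ht

end Equivariance

/-! ### The squares of the reflections generate the kernel as a normal subgroup -/

section Presentation

variable {n : ℕ} {Q : Type*} [Group Q] {τ : WD n → Q}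

/-- The subgroup generated by the images of the reflections which only involve coordinates in `S`. -/
def coordSubgroup (τ : WD n → Q) (S : Finset (Fin n)) : Subgroup Q :=
  Subgroup.closure {x | ∃ i ∈ S, ∃ j ∈ S, ∃ ε, i ≠ j ∧ x = τ (R i j ε)}

lemma mem_coordSubgroup {S : Finset (Fin n)} {i j : Fin n} (hi : i ∈ S) (hj : j ∈ S)
    (hij : i ≠ j) (ε : ℤˣ) : τ (R i j ε) ∈ coordSubgroup τ S :=
  Subgroup.subset_closure ⟨i, hi, j, hj, ε, hij, rfl⟩

/-- Representatives of the cosets of the group on the coordinates `S` in the one on `S ∪ {j}`, one or more for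
every signed basis vector to which `e_j` can be moved. -/
lemma exists_coset_representative (hn : 2 ≤ n)
    (hsq : ∀ t ∈ reflectionsD n, τ t * τ t = 1)
    (hconj : ∀ s ∈ reflectionsD n, ∀ t ∈ reflectionsD n, τ s * τ t = τ (s * t * s) * τ s)
    {S : Finset (Fin n)} {j : Fin n} (hj : j ∉ S) {x : Q}
    (hx : x ∈ coordSubgroup τ (insert j S)) :
    ∃ z ∈ coordSubgroup τ S, x = z ∨ (∃ i ∈ S, ∃ ε, x = τ (R i j ε) * z) ∨
      ∃ i ∈ S, ∃ ε, x = τ (R i j ε) * (τ (R i j (-ε)) * z) := by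
  have hT := fun {i k : Fin n} (h : i ≠ k) ε => R_mem_reflectionsD hn h ε
  have hconj' : ∀ s ∈ reflectionsD n, ∀ t ∈ reflectionsD n, τ s * τ t = τ t * τ (t * s * t) := by
    intro s hs t ht
    have h := hconj t ht _ (conj_mem_reflectionsD' hn ht hs)
    rw [conj_conj_cancel hn ht] at h
    exact h.symm
  have hjS : ∀ {i}, i ∈ S → i ≠ j := fun h e => hj (e ▸ h)
  have key : ∀ y ∈ {x | ∃ i ∈ insert j S, ∃ k ∈ insert j S, ∃ ε, i ≠ k ∧ x = τ (R i k ε)},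
      ∀ x, (∃ z ∈ coordSubgroup τ S, x = z ∨ (∃ i ∈ S, ∃ ε, x = τ (R i j ε) * z) ∨
      ∃ i ∈ S, ∃ ε, x = τ (R i j ε) * (τ (R i j (-ε)) * z)) →
      ∃ z ∈ coordSubgroup τ S, y * x = z ∨ (∃ i ∈ S, ∃ ε, y * x = τ (R i j ε) * z) ∨
      ∃ i ∈ S, ∃ ε, y * x = τ (R i j ε) * (τ (R i j (-ε)) * z) := by
    -- multiplication by a reflection which moves `j`
    have hkj : ∀ k ∈ S, ∀ δ, ∀ x,
        (∃ z ∈ coordSubgroup τ S, x = z ∨ (∃ i ∈ S, ∃ ε, x = τ (R i j ε) * z) ∨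
        ∃ i ∈ S, ∃ ε, x = τ (R i j ε) * (τ (R i j (-ε)) * z)) →
        ∃ z ∈ coordSubgroup τ S, τ (R k j δ) * x = z ∨
        (∃ i ∈ S, ∃ ε, τ (R k j δ) * x = τ (R i j ε) * z) ∨
        ∃ i ∈ S, ∃ ε, τ (R k j δ) * x = τ (R i j ε) * (τ (R i j (-ε)) * z) := by
      rintro k hk δ x ⟨z, hz, rfl | ⟨i, hi, ε, rfl⟩ | ⟨i, hi, ε, rfl⟩⟩
      · exact ⟨x, hz, Or.inr (Or.inl ⟨k, hk, δ, rfl⟩)⟩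
      · by_cases hik : i = k
        · subst hik
          by_cases hε : ε = δ
          · subst hε
            exact ⟨z, hz, Or.inl (by rw [← mul_assoc, hsq _ (hT (hjS hi) _), one_mul])⟩
          · rw [Int.units_ne_iff_eq_neg.1 hε]
            exact ⟨z, hz, Or.inr (Or.inr ⟨i, hi, δ, rfl⟩)⟩
        · have h := hconj' _ (hT (hjS hk) δ) _ (hT (hjS hi) ε)
          rw [R_comm k j, R_conj_share (hjS hi) hik (hjS hk).symm, R_comm j k] at h
          exact ⟨τ (R i k (ε * δ)) * z, mul_mem (mem_coordSubgroup hi hk hik _) hz,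
            Or.inr (Or.inl ⟨i, hi, ε, by rw [← mul_assoc, h, mul_assoc]⟩)⟩
      · by_cases hik : i = k
        · subst hik
          by_cases hε : ε = δ
          · subst hε
            exact ⟨z, hz, Or.inr (Or.inl ⟨i, hi, -ε, by
              rw [← mul_assoc, hsq _ (hT (hjS hi) _), one_mul]⟩)⟩
          · rw [Int.units_ne_iff_eq_neg.1 hε, neg_neg]
            have h := hconj _ (hT (hjS hi) δ) _ (hT (hjS hi) (-δ))
            rw [R_conj_same] at h
            exact ⟨z, hz, Or.inr (Or.inl ⟨i, hi, -δ, by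
              rw [← mul_assoc, h, mul_assoc, ← mul_assoc (τ (R i j δ)), hsq _ (hT (hjS hi) _),
                one_mul]⟩)⟩
        · have h1 := hconj _ (hT (hjS hk) δ) _ (hT (hjS hi) ε)
          have h2 := hconj _ (hT (hjS hk) δ) _ (hT (hjS hi) (-ε))
          rw [R_comm i j, R_conj_share (hjS hk) (Ne.symm hik) (hjS hi).symm, R_comm j i] at h1 h2
          have h3 := hconj _ (hT (Ne.symm hik) (δ * -ε)) _ (hT (hjS hk) δ)
          rw [R_comm k i, R_conj_share hik (hjS hi) (hjS hk), R_comm i k] at h3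
          have h4 := hconj _ (hT (Ne.symm hik) (δ * ε)) _ (hT (hjS hi) (δ * -ε * δ))
          rw [R_conj_share (Ne.symm hik) (hjS hk) (hjS hi)] at h4
          refine ⟨τ (R k i (δ * ε)) * (τ (R k i (δ * -ε)) * z),
            mul_mem (mem_coordSubgroup hk hi (Ne.symm hik) _)
              (mul_mem (mem_coordSubgroup hk hi (Ne.symm hik) _) hz),
            Or.inr (Or.inl ⟨k, hk, δ * ε * (δ * -ε * δ), ?_⟩)⟩
          calc τ (R k j δ) * (τ (R i j ε) * (τ (R i j (-ε)) * z))
              = τ (R k j δ) * τ (R i j ε) * τ (R i j (-ε)) * z := by group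
            _ = τ (R k i (δ * ε)) * (τ (R k j δ) * τ (R i j (-ε))) * z := by rw [h1]; group
            _ = τ (R k i (δ * ε)) * (τ (R k i (δ * -ε)) * τ (R k j δ)) * z := by rw [h2]
            _ = τ (R k i (δ * ε)) * τ (R i j (δ * -ε * δ)) * τ (R k i (δ * -ε)) * z := by
              rw [h3]; group
            _ = _ := by rw [h4]; group
    rintro y ⟨k, hk, l, hl, δ, hkl, rfl⟩ x hx
    rcases Finset.mem_insert.1 hk with rfl | hk'
    · have hl' : l ∈ S := (Finset.mem_insert.1 hl).resolve_left (Ne.symm hkl)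
      rw [R_comm]
      exact hkj l hl' δ x hx
    rcases Finset.mem_insert.1 hl with rfl | hl'
    · exact hkj k hk' δ x hx
    have hmem := mem_coordSubgroup (τ := τ) hk' hl' hkl δ
    have htT := hT hkl δ
    have htj : prm (R k l δ) j = j := by
      rw [prm_R, Equiv.swap_apply_of_ne_of_ne (hjS hk').symm (hjS hl').symm]
    have hti : ∀ i ∈ S, prm (R k l δ) i ∈ S := by
      intro i hi
      rw [prm_R, Equiv.swap_apply_def]
      split_ifs <;> assumption
    have hmove : ∀ i ∈ S, ∃ i' ∈ S, ∃ η : ℤˣ, ∀ ε,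
        τ (R k l δ) * τ (R i j ε) = τ (R i' j (ε * η)) * τ (R k l δ) := by
      intro i hi
      refine ⟨_, hti i hi, sgn (R k l δ) (prm (R k l δ) i) * sgn (R k l δ) j, fun ε => ?_⟩
      have h := conj_R (R k l δ) i j ε
      rw [R_inv, htj] at h
      rw [hconj _ htT _ (hT (hjS hi) ε), h, mul_assoc]
    rcases hx with ⟨z, hz, rfl | ⟨i, hi, ε, rfl⟩ | ⟨i, hi, ε, rfl⟩⟩
    · exact ⟨_, mul_mem hmem hz, Or.inl rfl⟩
    · obtain ⟨i', hi', η, h⟩ := hmove i hi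
      exact ⟨_, mul_mem hmem hz, Or.inr (Or.inl ⟨i', hi', ε * η, by
        rw [← mul_assoc, h, mul_assoc]⟩)⟩
    · obtain ⟨i', hi', η, h⟩ := hmove i hi
      exact ⟨_, mul_mem hmem hz, Or.inr (Or.inr ⟨i', hi', ε * η, by
        rw [← mul_assoc, h, mul_assoc, ← mul_assoc (τ (R k l δ)), h, neg_mul, mul_assoc]⟩)⟩
  have hone : ∃ z ∈ coordSubgroup τ S, (1 : Q) = z ∨ (∃ i ∈ S, ∃ ε, 1 = τ (R i j ε) * z) ∨
      ∃ i ∈ S, ∃ ε, 1 = τ (R i j ε) * (τ (R i j (-ε)) * z) := ⟨1, one_mem _, Or.inl rfl⟩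
  induction hx using Subgroup.closure_induction_left with
  | one => exact hone
  | mul_left y hy x _ ih => exact key y hy x ih
  | inv_mul_cancel y hy x _ ih =>
    have hy' : y⁻¹ = y := by
      obtain ⟨i, -, k, -, ε, hik, rfl⟩ := hy
      exact inv_eq_of_mul_eq_one_left (hsq _ (hT hik ε))
    rw [hy']
    exact key y hy x ih

/-- The group `W(D_n)` is presented by its reflections, with the relations which say that they are
involutions and that conjugation permutes them: an element which becomes trivial in `W(D_n)` fixes the last
basis vector, so it only involves the other coordinates. -/
lemma injective_of_conj (hn : 2 ≤ n) (f : Q →* WD n)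
    (hf : ∀ t ∈ reflectionsD n, f (τ t) = t)
    (hsq : ∀ t ∈ reflectionsD n, τ t * τ t = 1)
    (hconj : ∀ s ∈ reflectionsD n, ∀ t ∈ reflectionsD n, τ s * τ t = τ (s * t * s) * τ s)
    (hgen : Subgroup.closure (τ '' reflectionsD n) = ⊤) : Function.Injective f := by
  have hfix : ∀ S : Finset (Fin n), ∀ j ∉ S, ∀ z ∈ coordSubgroup τ S,
      FixesBasis (f z) j := by
    intro S j hj z hz
    induction hz using Subgroup.closure_induction with
    | mem x hx =>
      obtain ⟨i, hi, k, hk, ε, hik, rfl⟩ := hx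
      rw [hf _ (R_mem_reflectionsD hn hik ε)]
      exact fixesBasis_R (fun e => hj (by rw [e]; exact hi)) (fun e => hj (by rw [e]; exact hk)) ε
    | one => rw [map_one]; exact ⟨rfl, rfl⟩
    | mul x y _ _ hx hy => rw [map_mul]; exact hx.mul hy
    | inv x _ hx =>
      have h1 : prm (f x)⁻¹ j = j := by rw [prm_inv, Equiv.Perm.inv_eq_iff_eq, hx.1]
      have h2 : (prm (f x))⁻¹ j = j := h1
      rw [map_inv]
      refine ⟨h1, ?_⟩
      have h3 : sgn (f x * (f x)⁻¹) j = 1 := by rw [mul_inv_cancel]; rfl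
      rwa [sgn_mul, hx.2, one_mul, h2] at h3
  have key : ∀ S : Finset (Fin n), ∀ x ∈ coordSubgroup τ S, f x = 1 → x = 1 := by
    intro S
    induction S using Finset.induction_on with
    | empty =>
      intro x hx _
      have h : {x : Q | ∃ i ∈ (∅ : Finset (Fin n)), ∃ j ∈ (∅ : Finset (Fin n)), ∃ ε, i ≠ j ∧
          x = τ (R i j ε)} = ∅ := by
        ext x; simp
      rw [coordSubgroup, h, Subgroup.closure_empty] at hx
      exact Subgroup.mem_bot.1 hx
    | insert j S hj ih =>
      intro x hx h1
      have hjS : ∀ {i}, i ∈ S → i ≠ j := fun h e => hj (e ▸ h)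
      obtain ⟨z, hz, rfl | ⟨i, hi, ε, rfl⟩ | ⟨i, hi, ε, rfl⟩⟩ :=
        exists_coset_representative hn hsq hconj hj hx
      · exact ih x hz h1
      · exfalso
        have h2 := congrArg (fun g => prm g j) h1
        simp only [map_mul, prm_mul, Equiv.Perm.mul_apply, (hfix S j hj z hz).1,
          hf _ (R_mem_reflectionsD hn (hjS hi) ε), prm_R, Equiv.swap_apply_right, prm_one,
          Equiv.Perm.one_apply] at h2
        exact hjS hi h2
      · exfalso
        rw [map_mul, map_mul, hf _ (R_mem_reflectionsD hn (hjS hi) ε),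
          hf _ (R_mem_reflectionsD hn (hjS hi) (-ε))] at h1
        have h2 := congrArg (fun g => sgn g j) h1
        simp only [sgn_mul, prm_R, Equiv.swap_inv, Equiv.swap_apply_right,
          Equiv.swap_apply_left, (hfix S j hj z hz).2, sgn_R (hjS hi), sgn_one, true_or, or_true,
          if_true, mul_one] at h2
        rcases Int.units_eq_one_or ε with rfl | rfl <;> simp at h2
  rw [injective_iff_map_eq_one]
  intro x hx
  refine key Finset.univ x ?_ hx
  have h : coordSubgroup τ Finset.univ = ⊤ := by
    rw [eq_top_iff, ← hgen, Subgroup.closure_le]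
    rintro _ ⟨t, ht, rfl⟩
    obtain ⟨i, j, ε, hij, rfl⟩ := (mem_reflectionsD hn).1 ht
    exact mem_coordSubgroup (Finset.mem_univ i) (Finset.mem_univ j) hij ε
  rw [h]; trivial

end Presentation

section Kernel

variable {n : ℕ} {w : WD n} {c : Fin n → Bool} {χ : Fin n → Fin n → ℤˣ}

variable (w) in
/-- The normal subgroup of the interval group generated by the squares of the reflections. -/
def squares : Subgroup (IntervalGroup (reflectionsD n) w) :=
  Subgroup.normalClosure {x | ∃ t ∈ reflectionsD n, x = tau w t * tau w t}

instance : (squares w).Normal := Subgroup.normalClosure_normal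

lemma squares_le_ker (hn : 2 ≤ n) (hw : reflectionLength (reflectionsD n) w = n) :
    squares w ≤ (proj w).ker := by
  refine Subgroup.normalClosure_le_normal ?_
  rintro _ ⟨t, ht, rfl⟩
  change proj w _ = 1
  rw [map_mul, proj_tau (mem_interval_of_mem_reflectionsD hn hw ht),
    mul_self_of_mem_reflectionsD hn ht]

lemma ker_proj (hn : 2 ≤ n) (hw : reflectionLength (reflectionsD n) w = n)
    (hc : IsTwoCycle w c χ) : (proj w).ker = squares w := by
  refine le_antisymm ?_ (squares_le_ker hn hw)
  let π := QuotientGroup.mk' (squares w)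
  let τ : WD n → IntervalGroup (reflectionsD n) w ⧸ squares w := fun t => π (tau w t)
  have hsq : ∀ t ∈ reflectionsD n, τ t * τ t = 1 := by
    intro t ht
    change π _ * π _ = 1
    rw [← map_mul]
    exact (QuotientGroup.eq_one_iff _).2 (Subgroup.subset_normalClosure ⟨t, ht, rfl⟩)
  have hfam : IsDualBraidFamily w (fun t => (MulAut.conj (τ t)).toEquiv) τ := by
    refine ⟨?_, ?_, ?_, ?_⟩
    · intro t _
      change τ t * τ t * (τ t)⁻¹ = τ t
      rw [mul_inv_cancel_right]
    · intro s hs t _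
      change τ s * (τ s * τ t * (τ s)⁻¹) * (τ s)⁻¹ = τ t
      rw [inv_eq_of_mul_eq_one_left (hsq s hs)]
      calc τ s * (τ s * τ t * τ s) * τ s = (τ s * τ s) * τ t * (τ s * τ s) := by group
        _ = τ t := by rw [hsq s hs, one_mul, mul_one]
    · intro s hs t ht h
      change τ s * τ t * (τ s)⁻¹ = τ (s * t * s)
      rw [mul_inv_eq_iff_eq_mul]
      have := congrArg π (h.tau_mul_left hn hw hs ht)
      rwa [map_mul, map_mul] at this
    · intro s _ t _ h
      have h' : τ s * τ t * (τ s)⁻¹ = τ (s * t * s) := h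
      rw [mul_inv_eq_iff_eq_mul] at h'
      ext y
      change τ s * (τ t * y * (τ t)⁻¹) * (τ s)⁻¹ =
        τ (s * t * s) * (τ s * y * (τ s)⁻¹) * (τ (s * t * s))⁻¹
      calc τ s * (τ t * y * (τ t)⁻¹) * (τ s)⁻¹ = (τ s * τ t) * y * (τ s * τ t)⁻¹ := by group
        _ = _ := by rw [h']; group
  have hconj : ∀ s ∈ reflectionsD n, ∀ t ∈ reflectionsD n,
      τ s * τ t = τ (s * t * s) * τ s := by
    intro s hs t ht
    have h : τ s * τ t * (τ s)⁻¹ = τ (s * t * s) := hfam.apply_eq hn hc hs ht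
    rwa [mul_inv_eq_iff_eq_mul] at h
  have hgen : Subgroup.closure (τ '' reflectionsD n) = ⊤ := by
    have h := congrArg (Subgroup.map π) (closure_tau (w := w) hn hw)
    rw [MonoidHom.map_closure, Subgroup.map_top_of_surjective π
      (QuotientGroup.mk'_surjective _), Set.image_image] at h
    exact h
  have hinj := injective_of_conj hn
    (QuotientGroup.lift (squares w) (proj w) fun x hx => squares_le_ker hn hw hx)
    (fun t ht => proj_tau (mem_interval_of_mem_reflectionsD hn hw ht)) hsq hconj hgen
  intro x hx
  refine (QuotientGroup.eq_one_iff x).1 (hinj ?_)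
  rw [map_one]
  exact hx

end Kernel

/-! ### The abelianisation of the kernel -/

section AbelianizationConj

variable {G : Type*} [Group G] (N : Subgroup G)

open Classical in
/-- The class in the abelianisation of `N` of an element of `N`; by convention it is `1` for elements
outside `N`. -/
noncomputable def abCls (x : G) : Abelianization N :=
  if h : x ∈ N then Abelianization.of ⟨x, h⟩ else 1

variable {N}

lemma abCls_eq {x : G} (h : x ∈ N) : abCls N x = Abelianization.of ⟨x, h⟩ := dif_pos h

lemma abCls_mul {x y : G} (hx : x ∈ N) (hy : y ∈ N) :
    abCls N (x * y) = abCls N x * abCls N y := by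
  rw [abCls_eq hx, abCls_eq hy, abCls_eq (mul_mem hx hy), ← map_mul]; rfl

lemma abCls_one : abCls N (1 : G) = 1 := by
  rw [abCls_eq (one_mem N)]; exact map_one _

lemma abCls_inv {x : G} (hx : x ∈ N) : abCls N x⁻¹ = (abCls N x)⁻¹ := by
  rw [abCls_eq hx, abCls_eq (inv_mem hx), ← map_inv]; rfl

variable [N.Normal]

variable (N) in
/-- The action of a group by conjugation on the abelianisation of a normal subgroup. -/
def abConj : G →* MulAut (Abelianization N) where
  toFun g := (MulAut.conjNormal g : MulAut N).abelianizationCongr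
  map_one' := by
    ext x
    obtain ⟨x, rfl⟩ := QuotientGroup.mk_surjective x
    rw [map_one]
    rfl
  map_mul' g h := by
    ext x
    obtain ⟨x, rfl⟩ := QuotientGroup.mk_surjective x
    rw [map_mul]
    rfl

lemma abConj_abCls (g : G) {x : G} (hx : x ∈ N) :
    abConj N g (abCls N x) = abCls N (g * x * g⁻¹) := by
  rw [abCls_eq hx, abCls_eq (Subgroup.Normal.conj_mem inferInstance x hx g)]
  rfl

lemma abConj_of_mem {g : G} (hg : g ∈ N) : abConj N g = 1 := by
  ext x
  obtain ⟨⟨x, hx⟩, rfl⟩ := QuotientGroup.mk_surjective x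
  change abConj N g (Abelianization.of ⟨x, hx⟩) = Abelianization.of ⟨x, hx⟩
  rw [← abCls_eq hx, abConj_abCls g hx, abCls_mul (mul_mem hg hx) (inv_mem hg),
    abCls_mul hg hx, abCls_inv hg, mul_comm (abCls N g), mul_inv_cancel_right]

end AbelianizationConj

section Main

variable {n : ℕ} {w : WD n} {c : Fin n → Bool} {χ : Fin n → Fin n → ℤˣ}

variable (w) in
/-- The class of the square of the reflection `t` in the abelianisation of the kernel. -/
noncomputable def sqCls (t : WD n) : Abelianization (proj w).ker :=
  abCls (proj w).ker (tau w t * tau w t)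

lemma sq_mem_ker (hn : 2 ≤ n) (hw : reflectionLength (reflectionsD n) w = n) {t : WD n}
    (ht : t ∈ reflectionsD n) : tau w t * tau w t ∈ (proj w).ker := by
  rw [MonoidHom.mem_ker, map_mul, proj_tau (mem_interval_of_mem_reflectionsD hn hw ht),
    mul_self_of_mem_reflectionsD hn ht]

lemma abConj_tau_sqCls (hn : 2 ≤ n) (hw : reflectionLength (reflectionsD n) w = n)
    (hc : IsTwoCycle w c χ) {s t : WD n} (hs : s ∈ reflectionsD n) (ht : t ∈ reflectionsD n) :
    abConj (proj w).ker (tau w s) (sqCls w t) = sqCls w (s * t * s) := by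
  have hproj := fun {t : WD n} (ht : t ∈ reflectionsD n) =>
    proj_tau (mem_interval_of_mem_reflectionsD hn hw ht)
  have hfam : IsDualBraidFamily w (fun t => (abConj (proj w).ker (tau w t)).toEquiv)
      (sqCls w) := by
    refine ⟨?_, ?_, ?_, ?_⟩
    · intro t ht
      change abConj (proj w).ker (tau w t) (sqCls w t) = sqCls w t
      rw [sqCls, abConj_abCls _ (sq_mem_ker hn hw ht)]
      congr 1; group
    · intro s hs t _
      change abConj (proj w).ker (tau w s) (abConj (proj w).ker (tau w s) (sqCls w t)) = sqCls w t
      rw [← MulAut.mul_apply, ← map_mul, abConj_of_mem (sq_mem_ker hn hw hs), MulAut.one_apply]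
    · intro s hs t ht h
      change abConj (proj w).ker (tau w s) (sqCls w t) = sqCls w (s * t * s)
      have h1 := eq_mul_inv_of_mul_eq (h.tau_mul_left hn hw hs ht).symm
      rw [sqCls, abConj_abCls _ (sq_mem_ker hn hw ht), sqCls, h1]
      congr 1; group
    · intro s hs t ht _
      have hst := conj_mem_reflectionsD' hn hs ht
      have h1 : (tau w (s * t * s) * tau w s)⁻¹ * (tau w s * tau w t) ∈ (proj w).ker := by
        rw [MonoidHom.mem_ker]
        simp only [map_mul, map_inv, hproj hs, hproj ht, hproj hst]
        rw [mul_assoc (s * t) s s, mul_self_of_mem_reflectionsD hn hs, mul_one, inv_mul_cancel]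
      have h2 : abConj (proj w).ker (tau w s) * abConj (proj w).ker (tau w t) =
          abConj (proj w).ker (tau w (s * t * s)) * abConj (proj w).ker (tau w s) := by
        have h3 := abConj_of_mem h1
        rw [map_mul, map_inv, inv_mul_eq_one] at h3
        rw [← map_mul, ← map_mul, h3]
      exact Equiv.ext fun y => congrArg (fun f => f y) h2
  exact hfam.apply_eq hn hc hs ht

/-- The interval group permutes the classes of the squares of the reflections through `W(D_n)`. -/
lemma abConj_sqCls (hn : 2 ≤ n) (hw : reflectionLength (reflectionsD n) w = n)
    (hc : IsTwoCycle w c χ) (g : IntervalGroup (reflectionsD n) w) {t : WD n}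
    (ht : t ∈ reflectionsD n) :
    abConj (proj w).ker g (sqCls w t) = sqCls w (proj w g * t * (proj w g)⁻¹) := by
  have hg : g ∈ Subgroup.closure (tau w '' reflectionsD n) := by
    rw [closure_tau hn hw]; trivial
  induction hg using Subgroup.closure_induction generalizing t with
  | mem x hx =>
    obtain ⟨s, hs, rfl⟩ := hx
    rw [abConj_tau_sqCls hn hw hc hs ht, proj_tau (mem_interval_of_mem_reflectionsD hn hw hs),
      inv_of_mem_reflectionsD hn hs]
  | one => simp
  | mul x y _ _ hx hy =>
    rw [map_mul, MulAut.mul_apply, hy ht, hx (conj_mem_reflectionsD hn ht _), map_mul]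
    congr 1; group
  | inv x _ hx =>
    have h := hx (conj_mem_reflectionsD hn ht (proj w x)⁻¹)
    have e : proj w x * ((proj w x)⁻¹ * t * (proj w x)⁻¹⁻¹) * (proj w x)⁻¹ = t := by group
    rw [e] at h
    rw [map_inv, map_inv, ← h, ← MulAut.mul_apply, inv_mul_cancel, MulAut.one_apply]

lemma closure_sqCls (hn : 2 ≤ n) (hw : reflectionLength (reflectionsD n) w = n)
    (hc : IsTwoCycle w c χ) : Subgroup.closure (sqCls w '' reflectionsD n) = ⊤ := by
  rw [eq_top_iff]
  rintro y -
  obtain ⟨⟨x, hx⟩, rfl⟩ := QuotientGroup.mk_surjective y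
  change Abelianization.of (⟨x, hx⟩ : (proj w).ker) ∈ Subgroup.closure (sqCls w '' reflectionsD n)
  rw [← abCls_eq hx]
  have hx' : x ∈ squares w := by rwa [← ker_proj hn hw hc]
  have hle := squares_le_ker hn hw
  induction hx' using Subgroup.closure_induction with
  | mem x h =>
    obtain ⟨_, ⟨t, ht, rfl⟩, h2⟩ := Group.mem_conjugatesOfSet_iff.1 h
    obtain ⟨g, rfl⟩ := isConj_iff.1 h2
    rw [← abConj_abCls g (sq_mem_ker hn hw ht)]
    have h3 := abConj_sqCls hn hw hc g ht
    rw [sqCls] at h3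
    rw [h3]
    exact Subgroup.subset_closure (Set.mem_image_of_mem (sqCls w) (conj_mem_reflectionsD hn ht _))
  | one => rw [abCls_one]; exact one_mem _
  | mul x y hx' hy' ihx ihy =>
    rw [abCls_mul (hle hx') (hle hy')]
    exact mul_mem (ihx (hle hx')) (ihy (hle hy'))
  | inv x hx' ih =>
    rw [abCls_inv (hle hx')]
    exact inv_mem (ih (hle hx'))

/-! ### The relation in type `D_4` -/

variable (w) in
/-- The lift to the interval group, as a product of two commuting reflections, of the element which changes
the signs of `e_i` and `e_k`, for `i` and `k` of different colours. -/
noncomputable def dbl (i k : Fin n) : IntervalGroup (reflectionsD n) w :=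
  tau w (R i k 1) * tau w (R i k (-1))

lemma dbl_comm (i k : Fin n) : dbl w i k = dbl w k i := by
  rw [dbl, R_comm i k, R_comm i k, dbl]

lemma IsTwoCycle.tau_double_comm (hn : 2 ≤ n) (hw : reflectionLength (reflectionsD n) w = n)
    (hc : IsTwoCycle w c χ) {i k : Fin n} (hik : c i ≠ c k) :
    tau w (R i k 1) * tau w (R i k (-1)) = tau w (R i k (-1)) * tau w (R i k 1) := by
  have h := (hc.compat_double i k 1 hik).tau_mul_left hn hw
    (R_mem_reflectionsD hn (ne_of_color_ne hik) 1) (R_mem_reflectionsD hn (ne_of_color_ne hik) (-1))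
  rwa [R_conj_same] at h

lemma IsTwoCycle.tau_mul_dbl (hn : 2 ≤ n) (hw : reflectionLength (reflectionsD n) w = n)
    (hc : IsTwoCycle w c χ) {i k l : Fin n} (hik : c i ≠ c k) (hkl : c k = c l) (hne : k ≠ l)
    (hχ : χ k l = 1) : tau w (R k l 1) * dbl w i l = tau w (R k l (-1)) * dbl w i k := by
  have hil : c i ≠ c l := hkl ▸ hik
  have ik := ne_of_color_ne hik
  have il := ne_of_color_ne hil
  have hT := fun {i k : Fin n} (h : i ≠ k) ε => R_mem_reflectionsD hn h ε
  have h1 := (hc.compat_chord_cross i l k 1 1 hil hkl.symm hne.symm (by rw [hχ, one_mul])).tau_mul_right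
    hn hw (hT hne.symm 1) (hT il 1)
  rw [R_conj_share il ik hne.symm, one_mul] at h1
  have h2 := (hc.compat_cross_cross i k l 1 (-1) hik hkl hne (by rw [hχ]; rfl)).tau_mul_left
    hn hw (hT ik 1) (hT il (-1))
  rw [R_comm i k, R_conj_share ik.symm hne il, one_mul] at h2
  have h3 := (hc.compat_cross_chord i l k 1 (-1) hil hkl.symm hne.symm
    (by rw [hc.antisymm k l hne hkl, hχ]; rfl)).tau_mul_right hn hw (hT il 1) (hT hne.symm (-1))
  rw [R_comm i l, R_comm l k, R_conj_share hne ik.symm il.symm, mul_one] at h3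
  have h4 := hc.tau_double_comm hn hw hik.symm
  rw [R_comm k l, dbl, dbl, ← mul_assoc, h1, mul_assoc, R_comm i k, h2, ← mul_assoc, R_comm i l, h3,
    mul_assoc, R_comm i k, h4]

lemma sq_mul_inv_eq_conj {G : Type*} [Group G] {p p' q q' d₁₃ d₁₄ d₂₃ d₂₄ : G}
    (h1 : q * d₁₄ = q' * d₁₃) (h2 : q * d₂₄ = q' * d₂₃) (h3 : p * d₂₃ = p' * d₁₃)
    (hpq : Commute p q) (hpq' : Commute p q') (hp'q : Commute p' q) (hp'q' : Commute p' q') :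
    d₁₄ * d₁₄ * (d₁₃ * d₁₃)⁻¹ =
      (p'⁻¹ * p) * (d₂₄ * d₂₄ * (d₂₃ * d₂₃)⁻¹) * (p'⁻¹ * p)⁻¹ := by
  have hPQ : Commute (p'⁻¹ * p) (q⁻¹ * q') :=
    ((hp'q.inv_inv.mul_right hp'q'.inv_left).mul_left (hpq.inv_right.mul_right hpq'))
  have e1 : d₁₄ = (q⁻¹ * q') * d₁₃ := by rw [mul_assoc, ← h1, inv_mul_cancel_left]
  have e2 : d₂₄ = (q⁻¹ * q') * d₂₃ := by rw [mul_assoc, ← h2, inv_mul_cancel_left]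
  have e3 : d₁₃ = (p'⁻¹ * p) * d₂₃ := by rw [mul_assoc, h3, inv_mul_cancel_left]
  generalize q⁻¹ * q' = Q at *
  generalize p'⁻¹ * p = P at *
  subst e1 e2 e3
  calc Q * (P * d₂₃) * (Q * (P * d₂₃)) * (P * d₂₃ * (P * d₂₃))⁻¹
      = (Q * P) * d₂₃ * Q * d₂₃⁻¹ * P⁻¹ := by group
    _ = _ := by rw [← hPQ.eq]; group

end Main

section Relation

variable {n : ℕ} {w : WD n} {c : Fin n → Bool} {χ : Fin n → Fin n → ℤˣ}

variable (w) in
/-- The sum (written multiplicatively) of the classes of the two reflections which exchange `e_i` with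
`± e_k`. -/
noncomputable def pairCls (i k : Fin n) : Abelianization (proj w).ker :=
  sqCls w (R i k 1) * sqCls w (R i k (-1))

lemma pairCls_comm (i k : Fin n) : pairCls w i k = pairCls w k i := by
  rw [pairCls, R_comm i k, R_comm i k, pairCls]

lemma abConj_pairCls (hn : 2 ≤ n) (hw : reflectionLength (reflectionsD n) w = n)
    (hc : IsTwoCycle w c χ) (g : IntervalGroup (reflectionsD n) w) {i k : Fin n} (hik : i ≠ k) :
    abConj (proj w).ker g (pairCls w i k) =
      pairCls w (prm (proj w g) i) (prm (proj w g) k) := by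
  have hT := R_mem_reflectionsD hn hik
  rw [pairCls, map_mul, abConj_sqCls hn hw hc g (hT 1), abConj_sqCls hn hw hc g (hT (-1)),
    conj_R, conj_R, pairCls]
  simp only [neg_mul, one_mul]
  rcases Int.units_eq_one_or (sgn (proj w g) (prm (proj w g) i) *
    sgn (proj w g) (prm (proj w g) k)) with h | h
  · rw [h]
  · rw [h, neg_neg, mul_comm]

lemma dbl_mul_self (hn : 2 ≤ n) (hw : reflectionLength (reflectionsD n) w = n)
    (hc : IsTwoCycle w c χ) {i k : Fin n} (hik : c i ≠ c k) :
    dbl w i k * dbl w i k ∈ (proj w).ker ∧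
      abCls (proj w).ker (dbl w i k * dbl w i k) = pairCls w i k := by
  have h := hc.tau_double_comm hn hw hik
  have e : dbl w i k * dbl w i k = (tau w (R i k 1) * tau w (R i k 1)) *
      (tau w (R i k (-1)) * tau w (R i k (-1))) :=
    Commute.mul_mul_mul_comm (show Commute _ _ from h.symm) _ _
  have h1 := sq_mem_ker hn hw (R_mem_reflectionsD hn (ne_of_color_ne hik) 1)
  have h2 := sq_mem_ker hn hw (R_mem_reflectionsD hn (ne_of_color_ne hik) (-1))
  rw [e]
  exact ⟨mul_mem h1 h2, abCls_mul h1 h2⟩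

/-- The relation between the classes of the squares of the reflections of a subgroup of type `D_4`. The four
elements `dbl` differ by the elements of `tau_mul_dbl`, which commute for different cycles; comparing their
squares gives the relation. -/
lemma pairCls_mul_pairCls (hn : 2 ≤ n) (hw : reflectionLength (reflectionsD n) w = n)
    (hc : IsTwoCycle w c χ) {i j k l : Fin n} (hij : c i = c j) (hkl : c k = c l)
    (hik : c i ≠ c k) (hij' : i ≠ j) (hkl' : k ≠ l) (hχ : χ i j = 1) (hχ' : χ k l = 1) :
    pairCls w i l * pairCls w j k = pairCls w i k * pairCls w j l := by
  have hil : c i ≠ c l := hkl ▸ hik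
  have hjk : c j ≠ c k := hij ▸ hik
  have hjl : c j ≠ c l := hij ▸ hil
  have hcomm : ∀ ε δ, Commute (tau w (R i j ε)) (tau w (R k l δ)) := by
    intro ε δ
    have h := (hc.compat_chord_chord i j k l ε δ hij' hkl' hij hkl hik).tau_mul_left hn hw
      (R_mem_reflectionsD hn hij' ε) (R_mem_reflectionsD hn hkl' δ)
    rwa [R_conj_disjoint (ne_of_color_ne hik) (ne_of_color_ne hil) (ne_of_color_ne hjk)
      (ne_of_color_ne hjl)] at h
  have h3 := hc.tau_mul_dbl hn hw hik.symm hij hij' hχ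
  rw [dbl_comm k, dbl_comm k] at h3
  have key := sq_mul_inv_eq_conj (hc.tau_mul_dbl hn hw hik hkl hkl' hχ')
    (hc.tau_mul_dbl hn hw hjk hkl hkl' hχ') h3 (hcomm 1 1) (hcomm 1 (-1)) (hcomm (-1) 1)
    (hcomm (-1) (-1))
  obtain ⟨m1, e1⟩ := dbl_mul_self hn hw hc hil
  obtain ⟨m2, e2⟩ := dbl_mul_self hn hw hc hik
  obtain ⟨m3, e3⟩ := dbl_mul_self hn hw hc hjl
  obtain ⟨m4, e4⟩ := dbl_mul_self hn hw hc hjk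
  have h := congrArg (abCls (proj w).ker) key
  have hproj := fun ε => proj_tau (mem_interval_of_mem_reflectionsD hn hw
    (R_mem_reflectionsD hn hij' ε))
  have hperm : prm (proj w ((tau w (R i j (-1)))⁻¹ * tau w (R i j 1))) = 1 := by
    rw [map_mul, map_inv, hproj, hproj, prm_mul, prm_inv, prm_R, prm_R]; simp
  rw [← abConj_abCls _ (mul_mem m3 (inv_mem m4)), abCls_mul m1 (inv_mem m2), abCls_inv m2,
    abCls_mul m3 (inv_mem m4), abCls_inv m4, e1, e2, e3, e4, map_mul, map_inv,
    abConj_pairCls hn hw hc _ (ne_of_color_ne hjl), abConj_pairCls hn hw hc _ (ne_of_color_ne hjk),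
    hperm] at h
  simp only [Equiv.Perm.one_apply] at h
  rw [mul_inv_eq_iff_eq_mul, mul_right_comm] at h
  rw [h, inv_mul_cancel_right, mul_comm]

lemma finite_reflectionsD (hn : 2 ≤ n) : (reflectionsD n).Finite := by
  refine (Set.finite_range fun x : Fin n × Fin n × ℤˣ => R x.1 x.2.1 x.2.2).subset ?_
  intro t ht
  obtain ⟨i, j, ε, -, rfl⟩ := (mem_reflectionsD hn).1 ht
  exact ⟨(i, j, ε), rfl⟩

/-- Two of the reflections are superfluous in a generating set of the abelianisation of the kernel. -/
lemma exists_finset_closure_eq_top (hn : 2 ≤ n)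
    (hw : reflectionLength (reflectionsD n) w = n) (hc : IsTwoCycle w c χ) :
    ∃ F : Finset (Abelianization (proj w).ker),
      Subgroup.closure (F : Set (Abelianization (proj w).ker)) = ⊤ ∧
      F.card + 2 ≤ (reflectionsD n).ncard := by
  classical
  have horient : ∀ i : Fin n, ∃ j k, j ≠ k ∧ c j = c i ∧ c k = c i ∧ χ j k = 1 := by
    intro i
    obtain ⟨j, hji, hj⟩ := hc.exists_same i
    rcases Int.units_eq_one_or (χ i j) with h | h
    · exact ⟨i, j, hji.symm, rfl, hj, h⟩
    · refine ⟨j, i, hji, hj, rfl, ?_⟩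
      rw [hc.antisymm i j hji.symm hj.symm, h, neg_neg]
  obtain ⟨i, j, hij', hi, hj, hχ⟩ := horient ⟨0, by omega⟩
  obtain ⟨o, ho⟩ := hc.exists_other ⟨0, by omega⟩
  obtain ⟨k, l, hkl', hk, hl, hχ'⟩ := horient o
  have hij : c i = c j := hi.trans hj.symm
  have hkl : c k = c l := hk.trans hl.symm
  have hik : c i ≠ c k := by rw [hi, hk]; exact ho.symm
  have hil : c i ≠ c l := hkl ▸ hik
  have hjk : c j ≠ c k := hij ▸ hik
  have hjl : c j ≠ c l := hij ▸ hil
  have ik := ne_of_color_ne hik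
  have il := ne_of_color_ne hil
  have jk := ne_of_color_ne hjk
  have jl := ne_of_color_ne hjl
  have rel1 := pairCls_mul_pairCls hn hw hc hij hkl hik hij' hkl' hχ hχ'
  -- transport the first relation by the reflection which exchanges `e_i` and `e_k`
  have rel2 : pairCls w k l * pairCls w i j = pairCls w i k * pairCls w j l := by
    have h := congrArg (abConj (proj w).ker (tau w (R i k 1))) rel1
    rw [map_mul, map_mul, abConj_pairCls hn hw hc _ il, abConj_pairCls hn hw hc _ ik,
      abConj_pairCls hn hw hc _ jl, abConj_pairCls hn hw hc _ jk,
      proj_tau (mem_interval_of_mem_reflectionsD hn hw (R_mem_reflectionsD hn ik 1)), prm_R,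
      Equiv.swap_apply_left, Equiv.swap_apply_right, Equiv.swap_apply_of_ne_of_ne il.symm hkl'.symm,
      Equiv.swap_apply_of_ne_of_ne hij'.symm jk] at h
    rwa [pairCls_comm j i, pairCls_comm k i] at h
  have hT := fun {i k : Fin n} (h : i ≠ k) ε => R_mem_reflectionsD hn h ε
  set T' := reflectionsD n \ {R i l 1, R i j 1} with hT'
  have hfin : T'.Finite := (finite_reflectionsD hn).subset Set.sdiff_subset
  set C := Subgroup.closure (sqCls w '' T') with hC
  have hmem : ∀ t ∈ reflectionsD n, t ≠ R i l 1 → t ≠ R i j 1 → sqCls w t ∈ C :=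
    fun t ht h1 h2 => Subgroup.subset_closure (Set.mem_image_of_mem _ ⟨ht, by simp [h1, h2]⟩)
  have hprm : ∀ {a b x y : Fin n} {ε δ : ℤˣ}, Equiv.swap a b ≠ Equiv.swap x y →
      R a b ε ≠ R x y δ := by
    intro a b x y ε δ h e
    have := congrArg prm e
    rw [prm_R, prm_R] at this
    exact h this
  have hswap : ∀ {a b x y : Fin n}, x ≠ y → y ≠ a → y ≠ b → Equiv.swap a b ≠ Equiv.swap x y := by
    intro a b x y hxy h1 h2 e
    have := congrArg (fun σ => σ y) e
    simp only [Equiv.swap_apply_right, Equiv.swap_apply_of_ne_of_ne h1 h2] at this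
    exact hxy this.symm
  have hpair : ∀ {a b : Fin n}, a ≠ b → Equiv.swap a b ≠ Equiv.swap i l →
      Equiv.swap a b ≠ Equiv.swap i j → pairCls w a b ∈ C := by
    intro a b hab h1 h2
    exact mul_mem (hmem _ (hT hab 1) (hprm h1) (hprm h2))
      (hmem _ (hT hab (-1)) (hprm h1) (hprm h2))
  have hne1 : (1 : ℤˣ) ≠ -1 := by decide
  have hswap' : Equiv.swap i l ≠ Equiv.swap i j := hswap hij' hij'.symm jl
  have hsum : pairCls w i k * pairCls w j l ∈ C := by
    refine mul_mem (hpair ik (hswap il il.symm hkl'.symm) (hswap hij' hij'.symm jk)) (hpair jl ?_ ?_)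
    · rw [Equiv.swap_comm i l]; exact hswap il.symm hij' il
    · rw [Equiv.swap_comm i j]; exact hswap hij'.symm hij' il
  have hcancel : ∀ {x y z : Abelianization (proj w).ker}, x * y * z ∈ C → y ∈ C → z ∈ C → x ∈ C := by
    intro x y z h h1 h2
    rwa [mul_assoc, Subgroup.mul_mem_cancel_right _ (mul_mem h1 h2)] at h
  have h_il : sqCls w (R i l 1) ∈ C := by
    have h := hsum
    rw [← rel1, pairCls] at h
    refine hcancel h (hmem _ (hT il (-1)) (fun e => hne1 (R_sign_injective il e).symm)
      (hprm hswap')) (hpair jk (hswap il jl.symm hkl'.symm) ?_)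
    rw [Equiv.swap_comm i j]; exact hswap hij'.symm hij' ik
  have h_ij : sqCls w (R i j 1) ∈ C := by
    have h := hsum
    rw [← rel2, mul_comm, pairCls] at h
    refine hcancel h (hmem _ (hT hij' (-1)) (hprm hswap'.symm)
      (fun e => hne1 (R_sign_injective hij' e).symm)) (hpair hkl' ?_ (hswap hij' jk jl))
    rw [Equiv.swap_comm i l]; exact hswap il.symm ik il
  refine ⟨(hfin.image (sqCls w)).toFinset, ?_, ?_⟩
  · rw [Set.Finite.coe_toFinset, ← hC, eq_top_iff, ← closure_sqCls hn hw hc, Subgroup.closure_le]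
    rintro _ ⟨t, ht, rfl⟩
    by_cases h1 : t = R i l 1
    · rw [h1]; exact h_il
    by_cases h2 : t = R i j 1
    · rw [h2]; exact h_ij
    exact hmem t ht h1 h2
  · rw [← Set.ncard_eq_toFinset_card _ (hfin.image _)]
    have h1 := Set.ncard_image_le (f := sqCls w) hfin
    have h2 : ({R i l 1, R i j 1} : Set (WD n)).ncard = 2 := Set.ncard_pair (hprm hswap')
    have h3 := Set.ncard_sdiff_add_ncard_of_subset (s := {R i l 1, R i j 1}) (t := reflectionsD n) (by
      rintro x (rfl | rfl)
      exacts [hT il 1, hT hij' 1]) (finite_reflectionsD hn)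
    rw [h2, ← hT'] at h3
    omega

end Relation

end IntervalGroups

theorem mainTheorem11 (m n : ℕ) (hn : 4 ≤ n) (hm : 1 < m) (hmn : 2 * m ≤ n)
    (w : IntervalGroups.WD n) (s : Fin n → IntervalGroups.WD n)
    (hw : IntervalGroups.IsQuasiCoxeter (IntervalGroups.reflectionsD n) w)
    (hs : IntervalGroups.IsCarterDecomposition (IntervalGroups.reflectionsD n) w
      (IntervalGroups.carterDiagramD m n) s) :
    ∃ hmem : ∀ i, s i ∈ IntervalGroups.interval (IntervalGroups.reflectionsD n) w,
      (∃! φ : IntervalGroups.IntervalGroup (IntervalGroups.reflectionsD n) w →*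
          IntervalGroups.WD n,
        ∀ i, φ (IntervalGroups.gen (IntervalGroups.reflectionsD n) w ⟨s i, hmem i⟩) = s i) ∧
      ∀ φ : IntervalGroups.IntervalGroup (IntervalGroups.reflectionsD n) w →*
          IntervalGroups.WD n,
        (∀ i, φ (IntervalGroups.gen (IntervalGroups.reflectionsD n) w ⟨s i, hmem i⟩) = s i) →
        ∃ F : Finset (Abelianization φ.ker),
          Subgroup.closure (F : Set (Abelianization φ.ker)) = ⊤ ∧
          F.card + 2 ≤ (IntervalGroups.reflectionsD n).ncard := by
  open IntervalGroups in
  have hn2 : 2 ≤ n := by omega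
  have hwl := hs.reflectionLength_eq
  obtain ⟨c, χ, hc⟩ := hs.exists_isTwoCycle hn hm hmn hw
  have hmem := fun i => mem_interval_of_mem_reflectionsD hn2 hwl (hs.mem i)
  have huniq : ∀ φ : IntervalGroup (reflectionsD n) w →* WD n,
      (∀ i, φ (gen (reflectionsD n) w ⟨s i, hmem i⟩) = s i) → φ = proj w := by
    intro φ hφ
    refine MonoidHom.eq_of_eqOn_dense (hs.closure_tau_eq_top hn hm hmn hc) ?_
    rintro _ ⟨i, rfl⟩
    simp only
    rw [proj_tau (hmem i), tau_eq_gen (hmem i), hφ i]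
  refine ⟨hmem, ⟨proj w, fun i => ?_, huniq⟩, fun φ hφ => ?_⟩
  · rw [← tau_eq_gen (hmem i), proj_tau (hmem i)]
  · rw [huniq φ hφ]
    exact exists_finset_closure_eq_top hn2 hwl hc
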